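/- All vector spaces are over $\mathbb{C}$. A Lie conformal algebra is a $\mathbb{C}[\partial]$-module $R$ with a $\mathbb{C}$-bilinear $\lambda$-bracket $R\times R\to\mathbb{C}[\lambda]\otimes R$, $(x,y)\mapsto[x_\lambda y]$, satisfying $[(\partial x)_\lambda y]=-\lambda[x_\lambda y]$, $[x_\lambda(\partial y)]=(\partial+\lambda)[x_\lambda y]$, $[x_\lambda y]=-[y_{-\lambda-\partial}x]$ and $[x_\lambda[y_\mu z]]=[[x_\lambda y]_{\lambda+\mu}z]+[y_\mu[x_\lambda z]]$. A conformal module over $R$ is a $\mathbb{C}[\partial]$-module $V$ with a $\mathbb{C}$-bilinear map $R\times V\to\mathbb{C}[\lambda]\otimes V$, $(x,v)\mapsto x_\lambda v$, satisfying $(\partial x)_\lambda v=-\lambda x_\lambda v$, $x_\lambda(\partial v)=(\partial+\lambda)x_\lambda v$ and $x_\lambda(y_\mu v)-y_\mu(x_\lambda v)=[x_\lambda y]_{\lambda+\mu}v$. It is finite if it is finitely generated over $\mathbb{C}[\partial]$, trivial if $x_\lambda v=0$ for all $x\in R$, $v\in V$, and irreducible if it is nonzero and its only conformal submodules are $0$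 and itself. For $a,b,c\in\mathbb{C}$ let $TSV(a,b)$ and $TSV(c)$ be the Lie conformal algebras that are free over $\mathbb{C}[\partial]$ with basis $L,Y,M$ and have the following $\lambda$-brackets (the remaining ones being determined by sesquilinearity and skew-symmetry): - $TSV(a,b)$: $[L_\lambda L]=(\partial+2\lambda)L$, $[L_\lambda Y]=(\partial+a\lambda+b)Y$, $[L_\lambda M]=(\partial+2(a-1)\lambda+2b)M$, $[Y_\lambda Y]=(\partial+2\lambda)M$, $[Y_\lambda M]=[M_\lambda M]=0$; - $TSV(c)$: $[L_\lambda L]=(\partial+2\lambda)L$, $[L_\lambda Y]=(\partial+\frac32\lambda+c)Y$, $[L_\lambda M]=(\partial+2c)M$, $[Y_\lambda Y]=(\partial+2\lambda)(-\partial-2c)M$, $[Y_\lambda M]=[M_\lambda M]=0$. For $\alpha,\beta\in\mathbb{C}$ let $M_{\alpha,\beta}$ be the module, over $TSV(a,b)$ or over $TSV(c)$, that is free over $\mathbb{C}[\partial]$ on one generator $v$, with $L_\lambda v=(\partial+\alpha\lambda+\beta)v$ and $Y_\lambda v=M_\lambda v=0$. For $\alpha,\beta,\gamma\in\mathbb{C}$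 let $M_{\alpha,\beta,\gamma}$ be the $TSV(1,0)$-module that is free over $\mathbb{C}[\partial]$ on one generator $v$, with $L_\lambda v=(\partial+\alpha\lambda+\beta)v$, $Y_\lambda v=\gamma v$ and $M_\lambda v=0$. **Theorem.** (1) Let $V$ be a finite nontrivial irreducible conformal module over $TSV(a,b)$. Then $V$ is free of rank one over $\mathbb{C}[\partial]$. If $(a,b)\neq(1,0)$, then $V\cong M_{\alpha,\beta}$ for some $\alpha,\beta\in\mathbb{C}$ with $\alpha\neq0$. If $(a,b)=(1,0)$, then $V\cong M_{\alpha,\beta,\gamma}$ for some $\alpha,\beta,\gamma\in\mathbb{C}$ with $\alpha\neq0$ or $\gamma\neq0$. In particular $M_\lambda w=0$ for all $w\in V$. (2) Let $V$ be a finite nontrivial irreducible conformal module over $TSV(c)$. Then $V$ is free of rank one over $\mathbb{C}[\partial]$, and $V\cong M_{\alpha,\beta}$ for some $\alpha,\beta\in\mathbb{C}$ with $\alpha\neq0$. In particular $M_\lambda w=0$ for all $w\in V$. -/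

import Mathlib

open Polynomial TensorProduct

noncomputable section

/-! Throughout, a `ℂ[∂]`-module is a module over Mathlib's polynomial ring `ℂ[X]`, the variable `X`
acting as `∂`. The space `ℂ[λ] ⊗ N` is `ℂ[X] ⊗[ℂ] N`, the variable of its left factor being `λ`. -/

namespace Conformal

section Basic

variable (N : Type*) [AddCommGroup N] [Module ℂ N] [Module ℂ[X] N] [IsScalarTower ℂ ℂ[X] N]

/-- Multiplication by `λ` on `ℂ[λ] ⊗ N`. -/
def lam : Module.End ℂ (ℂ[X] ⊗[ℂ] N) :=
  LinearMap.rTensor N (LinearMap.mulLeft ℂ (X : ℂ[X]))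

/-- The action of `∂` on `ℂ[λ] ⊗ N` (through the factor `N`). -/
def del : Module.End ℂ (ℂ[X] ⊗[ℂ] N) :=
  LinearMap.lTensor ℂ[X] (Algebra.lsmul ℂ ℂ N (X : ℂ[X]))

variable {N}

/-- Substitution `λ ↦ q(∂)` in an element of `ℂ[λ] ⊗ N`, that is `p(λ) ⊗ n ↦ p(q(∂)) n`. -/
def subst (q : ℂ[X]) : ℂ[X] ⊗[ℂ] N →ₗ[ℂ] N :=
  TensorProduct.lift ((Algebra.lsmul ℂ ℂ N).toLinearMap ∘ₗ (aeval q : ℂ[X] →ₐ[ℂ] ℂ[X]).toLinearMap)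

/-- The value of an element of `ℂ[λ] ⊗ N` at a complex number `l`, that is `p(λ) ⊗ n ↦ p(l) n`.
By `ext_evalAt` below an element of `ℂ[λ] ⊗ N` is determined by its values, so that polynomial
identities in `λ`, `μ` are stated as identities between values at all complex numbers. -/
def evalAt (l : ℂ) : ℂ[X] ⊗[ℂ] N →ₗ[ℂ] N := subst (C l)

@[simp] lemma subst_tmul (q p : ℂ[X]) (n : N) : subst q (p ⊗ₜ[ℂ] n) = (p.comp q) • n := by
  simp [subst, Polynomial.aeval_def, Polynomial.comp, Polynomial.algebraMap_eq]

lemma evalAt_tmul (l : ℂ) (p : ℂ[X]) (n : N) : evalAt l (p ⊗ₜ[ℂ] n) = p.eval l • n := by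
  rw [evalAt, subst_tmul, Polynomial.comp_C, ← Polynomial.algebraMap_eq, algebraMap_smul]

lemma subst_lam (q : ℂ[X]) (x : ℂ[X] ⊗[ℂ] N) : subst q (lam N x) = q • subst q x := by
  induction x using TensorProduct.induction_on with
  | zero => simp
  | tmul p n => simp [lam, mul_smul]
  | add x y hx hy => simp [hx, hy]

lemma subst_del (q : ℂ[X]) (x : ℂ[X] ⊗[ℂ] N) : subst q (del N x) = (X : ℂ[X]) • subst q x := by
  induction x using TensorProduct.induction_on with
  | zero => simp
  | tmul p n => simp [del, smul_smul, mul_comm]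
  | add x y hx hy => simp [hx, hy]

lemma subst_aeval (q s : ℂ[X]) (T : Module.End ℂ (ℂ[X] ⊗[ℂ] N))
    (hT : ∀ x, subst q (T x) = s • subst q x) (f : ℂ[X]) (x : ℂ[X] ⊗[ℂ] N) :
    subst q (aeval T f x) = f.comp s • subst q x := by
  induction f using Polynomial.induction_on' generalizing x with
  | add f g hf hg => simp [hf, hg, add_smul]
  | monomial n c =>
    induction n generalizing x with
    | zero =>
      rw [Polynomial.monomial_zero_left, aeval_C, Polynomial.C_comp, Module.algebraMap_end_apply,
        map_smul, ← Polynomial.algebraMap_eq, algebraMap_smul]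
    | succ n ih =>
      have := ih (T x)
      simp only [← Polynomial.C_mul_X_pow_eq_monomial] at this ⊢
      rw [pow_succ, ← mul_assoc, map_mul, Module.End.mul_apply, aeval_X, this, hT, smul_smul]
      simp [mul_assoc]

/-- An element of `ℂ[λ] ⊗ N` is determined by its values at the complex numbers. -/
lemma ext_evalAt {x y : ℂ[X] ⊗[ℂ] N} (h : ∀ l : ℂ, evalAt l x = evalAt l y) : x = y := by
  classical
  let B := Module.Basis.ofVectorSpace ℂ N
  apply (TensorProduct.equivFinsuppOfBasisRight (M := ℂ[X]) B).injective
  ext1 i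
  apply Polynomial.funext
  intro l
  have key : ∀ z : ℂ[X] ⊗[ℂ] N,
      (TensorProduct.equivFinsuppOfBasisRight (M := ℂ[X]) B z i).eval l
        = B.repr (evalAt l z) i := by
    intro z
    induction z using TensorProduct.induction_on with
    | zero => simp
    | tmul p n => simp [evalAt_tmul, mul_comm]
    | add x y hx hy => simp [hx, hy]
  rw [key, key, h l]

/-- For a `ℂ[∂]`-submodule `S`, an element of `ℂ[λ] ⊗ N` lies in (the image of) `ℂ[λ] ⊗ S`
if and only if all its values lie in `S`. -/
lemma mem_range_iff_evalAt (S : Submodule ℂ[X] N) (x : ℂ[X] ⊗[ℂ] N) :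
    x ∈ LinearMap.range (LinearMap.lTensor ℂ[X] (S.subtype.restrictScalars ℂ)) ↔
      ∀ l : ℂ, evalAt l x ∈ S := by
  have hex : Function.Exact (S.subtype.restrictScalars ℂ) (S.mkQ.restrictScalars ℂ) := by
    intro y
    simp
  have hT := lTensor_exact ℂ[X] hex (by simpa using S.mkQ_surjective)
  have hev : ∀ (l : ℂ) (z : ℂ[X] ⊗[ℂ] N),
      evalAt l (LinearMap.lTensor ℂ[X] (S.mkQ.restrictScalars ℂ) z) = S.mkQ (evalAt l z) := by
    intro l z
    induction z using TensorProduct.induction_on with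
    | zero => simp
    | tmul p n => simp [evalAt_tmul]
    | add x y hx hy => simp only [map_add, hx, hy]
  constructor
  · intro hx l
    have h0 := (hT x).2 hx
    have := hev l x
    rw [h0, map_zero] at this
    exact (Submodule.Quotient.mk_eq_zero S).1 this.symm
  · intro h
    refine (hT x).1 (ext_evalAt fun l => ?_)
    rw [hev, map_zero]
    exact (Submodule.Quotient.mk_eq_zero S).2 (h l)

end Basic

/-- A Lie conformal algebra structure on a `ℂ[∂]`-module `R`: a `ℂ`-bilinear `λ`-bracket
`R × R → ℂ[λ] ⊗ R` with conformal sesquilinearity, skew-symmetry and the Jacobi identity. -/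
structure LieConformalAlgebra (R : Type*) [AddCommGroup R] [Module ℂ R] [Module ℂ[X] R]
    [IsScalarTower ℂ ℂ[X] R] where
  bracket : R →ₗ[ℂ] R →ₗ[ℂ] ℂ[X] ⊗[ℂ] R
  del_bracket : ∀ (l : ℂ) (a b : R),
    evalAt l (bracket ((X : ℂ[X]) • a) b) = -(l • evalAt l (bracket a b))
  bracket_del : ∀ (l : ℂ) (a b : R),
    evalAt l (bracket a ((X : ℂ[X]) • b)) = (X + C l : ℂ[X]) • evalAt l (bracket a b)
  skew : ∀ (l : ℂ) (a b : R),
    evalAt l (bracket a b) = -subst (-C l - X) (bracket b a)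
  jacobi : ∀ (l m : ℂ) (a b c : R),
    evalAt l (bracket a (evalAt m (bracket b c))) =
      evalAt (l + m) (bracket (evalAt l (bracket a b)) c) +
        evalAt m (bracket b (evalAt l (bracket a c)))

section Modules

variable {R : Type*} [AddCommGroup R] [Module ℂ R] [Module ℂ[X] R] [IsScalarTower ℂ ℂ[X] R]

/-- A conformal module structure on a `ℂ[∂]`-module `V` over the Lie conformal algebra `A`:
a `ℂ`-bilinear `λ`-action `R × V → ℂ[λ] ⊗ V`. -/
structure ConformalModule (A : LieConformalAlgebra R) (V : Type*) [AddCommGroup V] [Module ℂ V]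
    [Module ℂ[X] V] [IsScalarTower ℂ ℂ[X] V] where
  act : R →ₗ[ℂ] V →ₗ[ℂ] ℂ[X] ⊗[ℂ] V
  del_act : ∀ (l : ℂ) (a : R) (v : V),
    evalAt l (act ((X : ℂ[X]) • a) v) = -(l • evalAt l (act a v))
  act_del : ∀ (l : ℂ) (a : R) (v : V),
    evalAt l (act a ((X : ℂ[X]) • v)) = (X + C l : ℂ[X]) • evalAt l (act a v)
  act_act : ∀ (l m : ℂ) (a b : R) (v : V),
    evalAt l (act a (evalAt m (act b v))) - evalAt m (act b (evalAt l (act a v))) =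
      evalAt (l + m) (act (evalAt l (A.bracket a b)) v)

variable {A : LieConformalAlgebra R}
  {V : Type*} [AddCommGroup V] [Module ℂ V] [Module ℂ[X] V] [IsScalarTower ℂ ℂ[X] V]
  {W : Type*} [AddCommGroup W] [Module ℂ W] [Module ℂ[X] W] [IsScalarTower ℂ ℂ[X] W]

/-- The module is trivial if `R` acts on it by zero. -/
def ConformalModule.IsTrivial (M : ConformalModule A V) : Prop :=
  ∀ (a : R) (v : V), M.act a v = 0

/-- A `ℂ[∂]`-submodule `S` is a conformal submodule if `a_λ v ∈ ℂ[λ] ⊗ S` for `a ∈ R`, `v ∈ S`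
(see `mem_range_iff_evalAt`). -/
def ConformalModule.IsConformalSubmodule (M : ConformalModule A V) (S : Submodule ℂ[X] V) : Prop :=
  ∀ (a : R), ∀ v ∈ S, ∀ l : ℂ, evalAt l (M.act a v) ∈ S

/-- The module is irreducible if it is nonzero and has no conformal submodule besides zero
and itself. -/
def ConformalModule.IsIrreducible (M : ConformalModule A V) : Prop :=
  Nontrivial V ∧ ∀ S : Submodule ℂ[X] V, M.IsConformalSubmodule S → S = ⊥ ∨ S = ⊤

/-- Isomorphism of conformal modules: a `ℂ[∂]`-linear bijection commuting with all `a_λ`. -/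
def ConformalModule.IsIso (M : ConformalModule A V) (M' : ConformalModule A W) : Prop :=
  ∃ e : V ≃ₗ[ℂ[X]] W, ∀ (a : R) (v : V) (l : ℂ),
    e (evalAt l (M.act a v)) = evalAt l (M'.act a (e v))

end Modules

section Sesquilinear

variable {N : Type*} [AddCommGroup N] [Module ℂ N] [Module ℂ[X] N] [IsScalarTower ℂ ℂ[X] N]

/-- The sesquilinear extension of the value `x ∈ ℂ[λ] ⊗ N` on a pair of generators:
`(f(∂), g(∂)) ↦ f(-λ) g(∂ + λ) x`. -/
def sesq (x : ℂ[X] ⊗[ℂ] N) : ℂ[X] →ₗ[ℂ] ℂ[X] →ₗ[ℂ] ℂ[X] ⊗[ℂ] N :=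
  LinearMap.mk₂ ℂ (fun f g => aeval (-lam N) f (aeval (del N + lam N) g x))
    (by intros; simp) (by intros; simp) (by intros; simp) (by intros; simp)

lemma subst_sesq (q : ℂ[X]) (x : ℂ[X] ⊗[ℂ] N) (f g : ℂ[X]) :
    subst q (sesq x f g) = (f.comp (-q) * g.comp (X + q)) • subst q x := by
  rw [sesq, LinearMap.mk₂_apply, subst_aeval q (-q), subst_aeval q (X + q), smul_smul]
  · intro x; simp [subst_lam, subst_del, add_smul]
  · intro x; simp [subst_lam]

end Sesquilinear

/-- The free `ℂ[∂]`-module on three generators `L`, `Y`, `M` (in this order). -/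
abbrev Free3 : Type := Fin 3 → ℂ[X]

/-- The generators `L`, `Y`, `M` of `Free3`. -/
def vecL : Free3 := ![1, 0, 0]
def vecY : Free3 := ![0, 1, 0]
def vecM : Free3 := ![0, 0, 1]

/-- The generators of `Free3`, as elements of `ℂ[λ] ⊗ Free3`. -/
def genL : ℂ[X] ⊗[ℂ] Free3 := 1 ⊗ₜ[ℂ] vecL
def genY : ℂ[X] ⊗[ℂ] Free3 := 1 ⊗ₜ[ℂ] vecY
def genM : ℂ[X] ⊗[ℂ] Free3 := 1 ⊗ₜ[ℂ] vecM

/-- The sesquilinear extension of a table of brackets of the generators. -/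
def tableBracket (P : Fin 3 → Fin 3 → ℂ[X] ⊗[ℂ] Free3) :
    Free3 →ₗ[ℂ] Free3 →ₗ[ℂ] ℂ[X] ⊗[ℂ] Free3 :=
  ∑ i, ∑ j, (sesq (P i j)).compl₁₂ (LinearMap.proj i) (LinearMap.proj j)

/-- The sesquilinear extension, to the rank one free module `ℂ[∂] v`, of given actions
`x 0 = L_λ v`, `x 1 = Y_λ v`, `x 2 = M_λ v` of the generators. -/
def tableAct (x : Fin 3 → ℂ[X] ⊗[ℂ] ℂ[X]) : Free3 →ₗ[ℂ] ℂ[X] →ₗ[ℂ] ℂ[X] ⊗[ℂ] ℂ[X] :=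
  ∑ i, (sesq (x i)).compl₁₂ (LinearMap.proj i) LinearMap.id

lemma subst_tableBracket (q : ℂ[X]) (P : Fin 3 → Fin 3 → ℂ[X] ⊗[ℂ] Free3) (f g : Free3) :
    subst q (tableBracket P f g) =
      ∑ i, ∑ j, ((f i).comp (-q) * (g j).comp (X + q)) • subst q (P i j) := by
  simp [tableBracket, subst_sesq]

lemma subst_tableAct (q : ℂ[X]) (x : Fin 3 → ℂ[X] ⊗[ℂ] ℂ[X]) (f : Free3) (g : ℂ[X]) :
    subst q (tableAct x f g) =
      ∑ i, ((f i).comp (-q) * g.comp (X + q)) • subst q (x i) := by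
  simp [tableAct, subst_sesq]

/-- `λ` and `∂` acting on `ℂ[λ] ⊗ Free3`. -/
abbrev lam3 : Module.End ℂ (ℂ[X] ⊗[ℂ] Free3) := lam Free3
abbrev del3 : Module.End ℂ (ℂ[X] ⊗[ℂ] Free3) := del Free3

/-- The brackets of the generators in `TSV(a,b)`:
`[L_λ L] = (∂ + 2λ) L`, `[L_λ Y] = (∂ + aλ + b) Y`, `[L_λ M] = (∂ + 2(a-1)λ + 2b) M`,
`[Y_λ Y] = (∂ + 2λ) M`, `[Y_λ M] = [M_λ M] = 0`. The brackets `[Y_λ L]`, `[M_λ L]`, `[M_λ Y]` are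
those which skew-symmetry forces. -/
def tsvTable (a b : ℂ) : Fin 3 → Fin 3 → ℂ[X] ⊗[ℂ] Free3 :=
  ![![(del3 + (2 : ℂ) • lam3) genL,
      (del3 + a • lam3 + b • 1) genY,
      (del3 + (2 * (a - 1)) • lam3 + (2 * b) • 1) genM],
    ![((a - 1) • del3 + a • lam3 - b • 1) genY,
      (del3 + (2 : ℂ) • lam3) genM,
      0],
    ![((2 * a - 3) • del3 + (2 * (a - 1)) • lam3 - (2 * b) • 1) genM,
      0,
      0]]

/-- The brackets of the generators in `TSV(c)`:
`[L_λ L] = (∂ + 2λ) L`, `[L_λ Y] = (∂ + (3/2)λ + c) Y`, `[L_λ M] = (∂ + 2c) M`,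
`[Y_λ Y] = (∂ + 2λ)(-∂ - 2c) M`, `[Y_λ M] = [M_λ M] = 0`. The brackets `[Y_λ L]`, `[M_λ L]`,
`[M_λ Y]` are those which skew-symmetry forces. -/
def tsvcTable (c : ℂ) : Fin 3 → Fin 3 → ℂ[X] ⊗[ℂ] Free3 :=
  ![![(del3 + (2 : ℂ) • lam3) genL,
      (del3 + (3 / 2 : ℂ) • lam3 + c • 1) genY,
      (del3 + (2 * c) • 1) genM],
    ![((1 / 2 : ℂ) • del3 + (3 / 2 : ℂ) • lam3 - c • 1) genY,
      (del3 + (2 : ℂ) • lam3) ((-del3 - (2 * c) • 1) genM),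
      0],
    ![(-del3 - (2 * c) • 1) genM,
      0,
      0]]

lemma subst_gen (q : ℂ[X]) : subst q genL = ![1, 0, 0] ∧ subst q genY = ![0, 1, 0] ∧
    subst q genM = ![0, 0, 1] := by
  simp [genL, genY, genM, vecL, vecY, vecM]

lemma subst_tsv (q : ℂ[X]) (a b : ℂ) (f g : Free3) :
    subst q (tableBracket (tsvTable a b) f g) =
      ![(f 0).comp (-q) * (g 0).comp (X + q) * (X + 2 * q),
        (f 0).comp (-q) * (g 1).comp (X + q) * (X + C a * q + C b) +
          (f 1).comp (-q) * (g 0).comp (X + q) * ((C a - 1) * X + C a * q - C b),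
        (f 0).comp (-q) * (g 2).comp (X + q) * (X + 2 * (C a - 1) * q + 2 * C b) +
          (f 1).comp (-q) * (g 1).comp (X + q) * (X + 2 * q) +
          (f 2).comp (-q) * (g 0).comp (X + q) *
            ((2 * C a - 3) * X + 2 * (C a - 1) * q - 2 * C b)] := by
  obtain ⟨h1, h2, h3⟩ := subst_gen q
  have e2 : (C 2 : ℂ[X]) = 2 := map_ofNat C 2
  have e3 : (C 3 : ℂ[X]) = 3 := map_ofNat C 3
  rw [subst_tableBracket]
  ext1 k
  fin_cases k <;>
    simp [Fin.sum_univ_three, tsvTable, subst_lam, subst_del, h1, h2, h3,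
      Polynomial.smul_eq_C_mul, e2, e3, -mul_eq_mul_left_iff] <;> ring

lemma subst_tsvc (q : ℂ[X]) (c : ℂ) (f g : Free3) :
    subst q (tableBracket (tsvcTable c) f g) =
      ![(f 0).comp (-q) * (g 0).comp (X + q) * (X + 2 * q),
        (f 0).comp (-q) * (g 1).comp (X + q) * (X + C (3 / 2) * q + C c) +
          (f 1).comp (-q) * (g 0).comp (X + q) * (C (1 / 2) * X + C (3 / 2) * q - C c),
        (f 0).comp (-q) * (g 2).comp (X + q) * (X + 2 * C c) +
          (f 1).comp (-q) * (g 1).comp (X + q) * ((X + 2 * q) * (-X - 2 * C c)) +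
          (f 2).comp (-q) * (g 0).comp (X + q) * (-X - 2 * C c)] := by
  obtain ⟨h1, h2, h3⟩ := subst_gen q
  have e2 : (C 2 : ℂ[X]) = 2 := map_ofNat C 2
  rw [subst_tableBracket]
  ext1 k
  fin_cases k <;>
    simp [Fin.sum_univ_three, tsvcTable, subst_lam, subst_del, h1, h2, h3,
      Polynomial.smul_eq_C_mul, e2, -mul_eq_mul_left_iff] <;> ring

lemma comp_neg_C (p : ℂ[X]) (l : ℂ) : p.comp (-C l) = C (p.eval (-l)) := by
  rw [← C_neg, comp_C]

lemma comp_shift_neg (p : ℂ[X]) (l m : ℂ) :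
    (p.comp (X + C l)).comp (-C (l + m)) = C (p.eval (-m)) := by
  rw [comp_assoc, ← comp_neg_C]
  congr 1
  simp

lemma comp_shift_shift (p : ℂ[X]) (l m : ℂ) :
    (p.comp (X + C l)).comp (X + C m) = p.comp (X + C (l + m)) := by
  rw [comp_assoc]
  congr 1
  simp only [add_comp, X_comp, C_comp, C_add]
  ring

lemma del_tableBracket (P : Fin 3 → Fin 3 → ℂ[X] ⊗[ℂ] Free3) (l : ℂ) (a b : Free3) :
    evalAt l (tableBracket P ((X : ℂ[X]) • a) b) = -(l • evalAt l (tableBracket P a b)) := by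
  simp only [evalAt, subst_tableBracket, Finset.smul_sum, ← Finset.sum_neg_distrib]
  refine Finset.sum_congr rfl fun i _ => Finset.sum_congr rfl fun j _ => ?_
  rw [← algebraMap_smul ℂ[X] l, smul_smul, ← neg_smul]
  simp [mul_comp, mul_assoc]

lemma tableBracket_del (P : Fin 3 → Fin 3 → ℂ[X] ⊗[ℂ] Free3) (l : ℂ) (a b : Free3) :
    evalAt l (tableBracket P a ((X : ℂ[X]) • b)) =
      (X + C l : ℂ[X]) • evalAt l (tableBracket P a b) := by
  simp only [evalAt, subst_tableBracket, Finset.smul_sum]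
  refine Finset.sum_congr rfl fun i _ => Finset.sum_congr rfl fun j _ => ?_
  rw [smul_smul]
  congr 1
  simp [mul_comp]
  ring

lemma del_tableAct (x : Fin 3 → ℂ[X] ⊗[ℂ] ℂ[X]) (l : ℂ) (a : Free3) (v : ℂ[X]) :
    evalAt l (tableAct x ((X : ℂ[X]) • a) v) = -(l • evalAt l (tableAct x a v)) := by
  simp only [evalAt, subst_tableAct, Finset.smul_sum, ← Finset.sum_neg_distrib]
  refine Finset.sum_congr rfl fun i _ => ?_
  rw [← algebraMap_smul ℂ[X] l, smul_smul, ← neg_smul]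
  simp [mul_comp, mul_assoc]

lemma tableAct_del (x : Fin 3 → ℂ[X] ⊗[ℂ] ℂ[X]) (l : ℂ) (a : Free3) (v : ℂ[X]) :
    evalAt l (tableAct x a ((X : ℂ[X]) • v)) =
      (X + C l : ℂ[X]) • evalAt l (tableAct x a v) := by
  simp only [evalAt, subst_tableAct, Finset.smul_sum]
  refine Finset.sum_congr rfl fun i _ => ?_
  rw [smul_smul]
  congr 1
  simp [mul_comp]
  ring

/-- The Lie conformal algebra `TSV(a,b)`. -/
def TSV (a b : ℂ) : LieConformalAlgebra Free3 where
  bracket := tableBracket (tsvTable a b)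
  del_bracket := del_tableBracket _
  bracket_del := tableBracket_del _
  skew l f g := by
    have h1 : -(-C l - X) = (X + C l : ℂ[X]) := by ring
    have h2 : X + (-C l - X) = (-C l : ℂ[X]) := by ring
    rw [evalAt, subst_tsv, subst_tsv, h1, h2]
    ext1 k
    fin_cases k <;> simp <;> ring
  jacobi l m f g h := by
    simp only [evalAt, subst_tsv]
    ext1 k
    fin_cases k <;>
      simp only [Matrix.cons_val, Pi.add_apply, mul_comp, add_comp, sub_comp, X_comp, C_comp,
        ofNat_comp, one_comp, comp_neg_C, comp_shift_neg, comp_shift_shift, add_comm m l,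
        Fin.zero_eta, Fin.mk_one, Fin.reduceFinMk] <;> simp <;> ring

/-- The Lie conformal algebra `TSV(c)`. -/
def TSVc (c : ℂ) : LieConformalAlgebra Free3 where
  bracket := tableBracket (tsvcTable c)
  del_bracket := del_tableBracket _
  bracket_del := tableBracket_del _
  skew l f g := by
    have h1 : -(-C l - X) = (X + C l : ℂ[X]) := by ring
    have h2 : X + (-C l - X) = (-C l : ℂ[X]) := by ring
    have e3 : (C (3 / 2) : ℂ[X]) = C (1 / 2) + 1 := by rw [← C_1, ← C_add]; norm_num
    rw [evalAt, subst_tsvc, subst_tsvc, h1, h2, e3]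
    ext1 k
    fin_cases k <;> simp <;> ring
  jacobi l m f g h := by
    simp only [evalAt, subst_tsvc]
    ext1 k
    fin_cases k <;>
      simp only [Matrix.cons_val, Pi.add_apply, mul_comp, add_comp, sub_comp, X_comp, C_comp,
        ofNat_comp, one_comp, neg_comp, comp_neg_C, comp_shift_neg, comp_shift_shift,
        add_comm m l, Fin.zero_eta, Fin.mk_one, Fin.reduceFinMk] <;>
      refine Polynomial.funext fun x => ?_ <;> simp <;> ring

/-- The generator `v` of `ℂ[∂] v = ℂ[X]`, inside `ℂ[λ] ⊗ ℂ[∂] v`. -/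
def genV : ℂ[X] ⊗[ℂ] ℂ[X] := 1 ⊗ₜ[ℂ] 1

/-- The actions `L_λ v = (∂ + αλ + β) v`, `Y_λ v = γ v`, `M_λ v = 0` of the generators. -/
def rankOneTable (α β γ : ℂ) : Fin 3 → ℂ[X] ⊗[ℂ] ℂ[X] :=
  ![(del _ + α • lam _ + β • 1 : Module.End ℂ (ℂ[X] ⊗[ℂ] ℂ[X])) genV, γ • genV, 0]

lemma subst_rankOne (q : ℂ[X]) (α β γ : ℂ) (f : Free3) (g : ℂ[X]) :
    subst q (tableAct (rankOneTable α β γ) f g) =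
      (f 0).comp (-q) * g.comp (X + q) * (X + C α * q + C β) +
        (f 1).comp (-q) * g.comp (X + q) * C γ := by
  have h : subst q genV = 1 := by simp [genV]
  rw [subst_tableAct]
  simp [Fin.sum_univ_three, rankOneTable, subst_lam, subst_del, h, Polynomial.smul_eq_C_mul]

/-- The `TSV(a,b)`-module `M_{α,β} = ℂ[∂] v`:
`L_λ v = (∂ + αλ + β) v`, `Y_λ v = M_λ v = 0`. -/
def modTSV (a b α β : ℂ) : ConformalModule (TSV a b) ℂ[X] where
  act := tableAct (rankOneTable α β 0)
  del_act := del_tableAct _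
  act_del := tableAct_del _
  act_act l m f g v := by
    simp only [evalAt, TSV, subst_tsv, subst_rankOne]
    simp only [Matrix.cons_val, mul_comp, add_comp, sub_comp, X_comp, C_comp,
        ofNat_comp, one_comp, comp_neg_C, comp_shift_neg, comp_shift_shift, add_comm m l]
    simp
    ring

/-- The `TSV(1,0)`-module `M_{α,β,γ} = ℂ[∂] v`:
`L_λ v = (∂ + αλ + β) v`, `Y_λ v = γ v`, `M_λ v = 0`. -/
def modTSV10 (α β γ : ℂ) : ConformalModule (TSV 1 0) ℂ[X] where
  act := tableAct (rankOneTable α β γ)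
  del_act := del_tableAct _
  act_del := tableAct_del _
  act_act l m f g v := by
    simp only [evalAt, TSV, subst_tsv, subst_rankOne]
    simp only [Matrix.cons_val, mul_comp, add_comp, sub_comp, X_comp, C_comp,
        ofNat_comp, one_comp, comp_neg_C, comp_shift_neg, comp_shift_shift, add_comm m l]
    simp
    ring

/-- The `TSV(c)`-module `M_{α,β} = ℂ[∂] v`:
`L_λ v = (∂ + αλ + β) v`, `Y_λ v = M_λ v = 0`. -/
def modTSVc (c α β : ℂ) : ConformalModule (TSVc c) ℂ[X] where
  act := tableAct (rankOneTable α β 0)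
  del_act := del_tableAct _
  act_del := tableAct_del _
  act_act l m f g v := by
    simp only [evalAt, TSVc, subst_tsvc, subst_rankOne]
    simp only [Matrix.cons_val, mul_comp, add_comp, sub_comp, X_comp, C_comp,
        ofNat_comp, one_comp, neg_comp, comp_neg_C, comp_shift_neg, comp_shift_shift, add_comm m l]
    simp
    ring

end Conformal

end

/-!
Write `A_λ v = ∑ λ ^ n A_(n) v` for the action of a generator `A` (without divided powers), and let
`lowDegree A k` be the space of the vectors `v` such that `A_λ v` has degree less than `k` in `λ`.
Since `A_λ ∂ = (∂ + λ) A_λ`, the first nonzero one of these spaces, if it is not `lowDegree A 0`,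
has vectors which are as independent over `ℂ[∂]` as they are over `ℂ`, so that it is
finite-dimensional (`IsConformalLinear.linearIndependent`). So finite-dimensional linear algebra applies to it, and a
single trace argument does the work: if `[A, B] = c N` with `N` injective and commuting with `A`,
then `c = 0`, because `[A, B N⁻¹] = c` has trace zero (`eq_zero_of_commutator`). By the choice of
the degree, the top coefficient of the generator is injective on the space in question.

* For `M`, the top coefficient `M_(k)` is a multiple of a commutator `[Y_(j), Y_(0)]` and commutes
  with `Y`. So `M` kills a nonzero vector (`exists_killed_of_commutator`), and irreducibility
  gives `M = 0`.
* After that `Y` is abelian. The commutators of `Y_(k)` with `L_0 - ∂` and with `L_(1)` give `b = 0`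
  and `a = k + 1`, and that of `Y_(k - 1)` with `L_(2)` excludes `k ≥ 1`. So `Y = 0` unless
  `(a, b) = (1, 0)`, in which case `Y_λ` may also be constant in `λ` on some nonzero vectors
  (`exists_killed_or_degree_zero`).
* Among the vectors on which `Y_λ` is constant in `λ`, those of minimal degree for `L` have degree
  at most one, as `[L_(1), L_(k)] = (1 - k) L_(k)`. On them `L_0 - ∂`, `L_(1)` and `Y_(0)` commute,
  and a common eigenvector `v` satisfies `L_λ v = (∂ + α λ + β) v` and `Y_λ v = γ v`
  (`exists_common_weight_vector`).

By irreducibility `ℂ[∂] v` is the whole module, and it is free. If `α = γ = 0`, then `(∂ + β) v`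
generates a proper nonzero submodule.
-/

noncomputable section

namespace Conformal

/-! ### Coefficients and values of elements of `ℂ[λ] ⊗ V` -/

section Coefficients

variable {V : Type*} [AddCommGroup V] [Module ℂ V]

/-- The coefficient of `λ ^ n` in an element of `ℂ[λ] ⊗ V`. -/
def coeffAt (n : ℕ) : ℂ[X] ⊗[ℂ] V →ₗ[ℂ] V :=
  (TensorProduct.lid ℂ V).toLinearMap ∘ₗ LinearMap.rTensor V (lcoeff ℂ n)

@[simp] lemma coeffAt_tmul (n : ℕ) (p : ℂ[X]) (v : V) :
    coeffAt n (p ⊗ₜ[ℂ] v) = p.coeff n • v := by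
  simp [coeffAt]

lemma coeffAt_lTensor (n : ℕ) (f : Module.End ℂ V) (z : ℂ[X] ⊗[ℂ] V) :
    coeffAt n (LinearMap.lTensor ℂ[X] f z) = f (coeffAt n z) := by
  induction z using TensorProduct.induction_on with
  | zero => simp
  | tmul p v => simp
  | add x y hx hy => simp [hx, hy]

lemma exists_eq_sum_X_pow_tmul (z : ℂ[X] ⊗[ℂ] V) :
    ∃ N, (∀ n ≥ N, coeffAt n z = 0) ∧
      z = ∑ n ∈ Finset.range N, (X ^ n : ℂ[X]) ⊗ₜ[ℂ] coeffAt n z := by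
  have key : ∃ N, (∀ n ≥ N, coeffAt n z = 0) ∧ ∀ N' ≥ N,
      z = ∑ n ∈ Finset.range N', (X ^ n : ℂ[X]) ⊗ₜ[ℂ] coeffAt n z := by
    induction z using TensorProduct.induction_on with
    | zero => exact ⟨0, by simp⟩
    | tmul p v =>
      refine ⟨p.natDegree + 1, fun n hn => ?_, fun N' hN' => ?_⟩
      · rw [coeffAt_tmul, coeff_eq_zero_of_natDegree_lt (by omega), zero_smul]
      · conv_lhs => rw [p.as_sum_range' N' (by omega), TensorProduct.sum_tmul]
        refine Finset.sum_congr rfl fun n _ => ?_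
        rw [coeffAt_tmul, TensorProduct.tmul_smul, TensorProduct.smul_tmul',
          ← Polynomial.smul_X_eq_monomial]
    | add x y hx hy =>
      obtain ⟨N₁, h₁, h₁'⟩ := hx
      obtain ⟨N₂, h₂, h₂'⟩ := hy
      refine ⟨max N₁ N₂, fun n hn => ?_, fun N' hN' => ?_⟩
      · rw [map_add, h₁ n (by omega), h₂ n (by omega), add_zero]
      · conv_lhs => rw [h₁' N' (by omega), h₂' N' (by omega)]
        simp only [map_add, TensorProduct.tmul_add, Finset.sum_add_distrib]
  obtain ⟨N, h, h'⟩ := key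
  exact ⟨N, h, h' N le_rfl⟩

lemma eq_sum_X_pow_tmul {z : ℂ[X] ⊗[ℂ] V} {N : ℕ} (h : ∀ n ≥ N, coeffAt n z = 0) :
    z = ∑ n ∈ Finset.range N, (X ^ n : ℂ[X]) ⊗ₜ[ℂ] coeffAt n z := by
  obtain ⟨N', h', hz⟩ := exists_eq_sum_X_pow_tmul z
  conv_lhs => rw [hz]
  have aux : ∀ K K', (∀ n ≥ K, coeffAt n z = 0) → K ≤ K' →
      ∑ n ∈ Finset.range K, (X ^ n : ℂ[X]) ⊗ₜ[ℂ] coeffAt n z =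
        ∑ n ∈ Finset.range K', (X ^ n : ℂ[X]) ⊗ₜ[ℂ] coeffAt n z := by
    intro K K' hK hKK
    refine Finset.sum_subset (Finset.range_mono hKK) fun n _ hn => ?_
    rw [hK n (by simpa using hn), TensorProduct.tmul_zero]
  rcases le_total N' N with hle | hle
  · exact aux _ _ h' hle
  · exact (aux _ _ h hle).symm

/-- Multiplication by a polynomial `h(λ)` on `ℂ[λ] ⊗ V`. -/
def mulPoly (h : ℂ[X]) : Module.End ℂ (ℂ[X] ⊗[ℂ] V) :=
  LinearMap.rTensor V (LinearMap.mulLeft ℂ h)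

lemma coeffAt_mulPoly_top (h : ℂ[X]) {z : ℂ[X] ⊗[ℂ] V} {k : ℕ}
    (hz : ∀ n ≥ k + 1, coeffAt n z = 0) :
    coeffAt (h.natDegree + k) (mulPoly h z) = h.leadingCoeff • coeffAt k z := by
  conv_lhs => rw [eq_sum_X_pow_tmul hz]
  rw [map_sum, map_sum, Finset.sum_range_succ, Finset.sum_eq_zero]
  · simp [mulPoly]
  · intro n hn
    have hn := Finset.mem_range.1 hn
    have : (h * X ^ n).coeff (h.natDegree + k) = 0 := by
      rw [coeff_mul_X_pow', if_pos (by omega)]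
      exact coeff_eq_zero_of_natDegree_lt (by omega)
    simp [mulPoly, this]

/-- The `n`-th divided derivative in `λ` on `ℂ[λ] ⊗ V`. -/
def hasse (n : ℕ) : Module.End ℂ (ℂ[X] ⊗[ℂ] V) :=
  LinearMap.rTensor V (hasseDeriv n)

lemma coeffAt_hasse (n k : ℕ) (z : ℂ[X] ⊗[ℂ] V) :
    coeffAt k (hasse n z) = ((k + n).choose n : ℂ) • coeffAt (k + n) z := by
  induction z using TensorProduct.induction_on with
  | zero => simp
  | tmul p v => simp [hasse, hasseDeriv_coeff, mul_smul]
  | add x y hx hy => simp [hx, hy]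

/-- The substitution `λ ↦ λ + l` on `ℂ[λ] ⊗ V`. -/
def shift (l : ℂ) : Module.End ℂ (ℂ[X] ⊗[ℂ] V) :=
  LinearMap.rTensor V (taylor l)

lemma coeffAt_lam_zero (z : ℂ[X] ⊗[ℂ] V) : coeffAt 0 (lam V z) = 0 := by
  induction z using TensorProduct.induction_on with
  | zero => simp
  | tmul p v => simp [lam]
  | add x y hx hy => simp [hx, hy]

lemma coeffAt_lam_succ (n : ℕ) (z : ℂ[X] ⊗[ℂ] V) :
    coeffAt (n + 1) (lam V z) = coeffAt n z := by
  induction z using TensorProduct.induction_on with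
  | zero => simp
  | tmul p v => simp [lam]
  | add x y hx hy => simp [hx, hy]

variable [Module ℂ[X] V] [IsScalarTower ℂ ℂ[X] V]

lemma C_smul_eq (l : ℂ) (v : V) : (C l : ℂ[X]) • v = l • v := by
  rw [← Polynomial.algebraMap_eq, algebraMap_smul]

lemma X_smul_smul (l : ℂ) (v : V) : (X : ℂ[X]) • l • v = l • (X : ℂ[X]) • v := by
  rw [← C_smul_eq, ← C_smul_eq, smul_smul, smul_smul, mul_comm]

lemma coeffAt_shift (n : ℕ) (l : ℂ) (z : ℂ[X] ⊗[ℂ] V) :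
    coeffAt n (shift l z) = evalAt l (hasse n z) := by
  induction z using TensorProduct.induction_on with
  | zero => simp
  | tmul p v => simp [shift, hasse, evalAt_tmul, taylor_coeff]
  | add x y hx hy => simp [hx, hy]

lemma evalAt_shift (l m : ℂ) (z : ℂ[X] ⊗[ℂ] V) :
    evalAt m (shift l z) = evalAt (l + m) z := by
  induction z using TensorProduct.induction_on with
  | zero => simp
  | tmul p v => simp [shift, evalAt_tmul, taylor_eval, add_comm]
  | add x y hx hy => simp [hx, hy]

lemma evalAt_mulPoly (l : ℂ) (h : ℂ[X]) (z : ℂ[X] ⊗[ℂ] V) :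
    evalAt l (mulPoly h z) = h.eval l • evalAt l z := by
  induction z using TensorProduct.induction_on with
  | zero => simp
  | tmul p v => simp [mulPoly, evalAt_tmul, mul_smul]
  | add x y hx hy => simp [hx, hy]

lemma evalAt_lam (l : ℂ) (z : ℂ[X] ⊗[ℂ] V) : evalAt l (lam V z) = l • evalAt l z := by
  rw [evalAt, subst_lam, C_smul_eq]

lemma evalAt_lTensor (l : ℂ) (f : Module.End ℂ V) (z : ℂ[X] ⊗[ℂ] V) :
    evalAt l (LinearMap.lTensor ℂ[X] f z) = f (evalAt l z) := by
  induction z using TensorProduct.induction_on with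
  | zero => simp
  | tmul p v => simp [evalAt_tmul]
  | add x y hx hy => simp [hx, hy]

lemma coeffAt_del (n : ℕ) (z : ℂ[X] ⊗[ℂ] V) :
    coeffAt n (del V z) = (X : ℂ[X]) • coeffAt n z := by
  induction z using TensorProduct.induction_on with
  | zero => simp
  | tmul p v => simp [del, X_smul_smul]
  | add x y hx hy => simp [hx, hy]

lemma evalAt_eq_sum (l : ℂ) {z : ℂ[X] ⊗[ℂ] V} {N : ℕ} (h : ∀ n ≥ N, coeffAt n z = 0) :
    evalAt l z = ∑ n ∈ Finset.range N, l ^ n • coeffAt n z := by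
  conv_lhs => rw [eq_sum_X_pow_tmul h]
  simp [evalAt_tmul]

lemma evalAt_zero_eq_coeffAt (z : ℂ[X] ⊗[ℂ] V) : evalAt 0 z = coeffAt 0 z := by
  induction z using TensorProduct.induction_on with
  | zero => simp
  | tmul p v => simp [evalAt_tmul, coeff_zero_eq_eval_zero]
  | add x y hx hy => simp [hx, hy]

end Coefficients

/-! ### Coefficients of operators depending on `λ` -/

section Modes

variable {V : Type*} [AddCommGroup V] [Module ℂ V]

/-- The coefficient of `λ ^ n` in `A_λ`, for a `ℂ`-linear map `A : v ↦ A_λ v`. -/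
def mode (A : V →ₗ[ℂ] ℂ[X] ⊗[ℂ] V) (n : ℕ) : Module.End ℂ V := coeffAt n ∘ₗ A

/-- The vectors `v` for which `A_λ v` has degree less than `k` in `λ`. -/
def lowDegree (A : V →ₗ[ℂ] ℂ[X] ⊗[ℂ] V) (k : ℕ) : Submodule ℂ V where
  carrier := {v | ∀ n ≥ k, mode A n v = 0}
  zero_mem' n _ := map_zero _
  add_mem' hv hw n hn := by rw [map_add, hv n hn, hw n hn, add_zero]
  smul_mem' c v hv n hn := by rw [map_smul, hv n hn, smul_zero]

lemma mem_lowDegree {A : V →ₗ[ℂ] ℂ[X] ⊗[ℂ] V} {k : ℕ} {v : V} :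
    v ∈ lowDegree A k ↔ ∀ n ≥ k, mode A n v = 0 := Iff.rfl

lemma mem_lowDegree_zero {A : V →ₗ[ℂ] ℂ[X] ⊗[ℂ] V} {v : V} :
    v ∈ lowDegree A 0 ↔ A v = 0 := by
  refine ⟨fun h => ?_, fun h n _ => by simp [mode, h]⟩
  rw [eq_sum_X_pow_tmul (z := A v) (N := 0) h, Finset.sum_range_zero]

lemma exists_mem_lowDegree (A : V →ₗ[ℂ] ℂ[X] ⊗[ℂ] V) (v : V) : ∃ k, v ∈ lowDegree A k :=
  let ⟨N, h, _⟩ := exists_eq_sum_X_pow_tmul (A v)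
  ⟨N, h⟩

lemma eq_zero_of_mode_eq_zero {A : V →ₗ[ℂ] ℂ[X] ⊗[ℂ] V} {k : ℕ} (hk : lowDegree A k = ⊥)
    {v : V} (hv : v ∈ lowDegree A (k + 1)) (h : mode A k v = 0) : v = 0 := by
  rw [← Submodule.mem_bot ℂ, ← hk]
  intro n hn
  rcases hn.eq_or_lt with rfl | hlt
  · exact h
  · exact hv n hlt

variable [Module ℂ[X] V] [IsScalarTower ℂ ℂ[X] V]

/-- The operator `A_l`, for a complex number `l` and a `ℂ`-linear map `A : v ↦ A_λ v`. -/
def value (A : V →ₗ[ℂ] ℂ[X] ⊗[ℂ] V) (l : ℂ) : Module.End ℂ V := evalAt l ∘ₗ A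

lemma value_zero (A : V →ₗ[ℂ] ℂ[X] ⊗[ℂ] V) : value A 0 = mode A 0 :=
  LinearMap.ext fun v => evalAt_zero_eq_coeffAt (A v)

/-- The coefficients of a commutator of `A_λ` with an operator `f`. -/
lemma mode_apply_sub {A : V →ₗ[ℂ] ℂ[X] ⊗[ℂ] V} {f : Module.End ℂ V} {v : V}
    {w : ℂ[X] ⊗[ℂ] V} (h : ∀ l, value A l (f v) - f (value A l v) = evalAt l w) (n : ℕ) :
    mode A n (f v) - f (mode A n v) = coeffAt n w := by
  have : A (f v) - LinearMap.lTensor ℂ[X] f (A v) = w := by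
    refine ext_evalAt fun l => ?_
    rw [map_sub, evalAt_lTensor, ← h]
    rfl
  rw [← this, map_sub, coeffAt_lTensor]
  rfl

lemma mode_comm_of_value_comm {A B : V →ₗ[ℂ] ℂ[X] ⊗[ℂ] V}
    (h : ∀ l m v, value A l (value B m v) = value B m (value A l v)) (m n : ℕ) (v : V) :
    mode A m (mode B n v) = mode B n (mode A m v) := by
  have h₁ : ∀ l, mode B n (value A l v) - value A l (mode B n v) = coeffAt n 0 := fun l =>
    mode_apply_sub (fun m => by rw [h, sub_self, map_zero]) n
  have h₂ := mode_apply_sub (A := A) (f := mode B n) (v := v) (w := 0)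
    (fun l => by rw [← neg_sub, h₁ l]; simp) m
  simpa [sub_eq_zero] using h₂

/-- The commutators of coefficients which follow from
`[P_λ, Q_μ] = (s λ - μ + t) R_{λ + μ}`. -/
lemma mode_comm {P Q R : V →ₗ[ℂ] ℂ[X] ⊗[ℂ] V} {s t : ℂ}
    (h : ∀ l m v, value P l (value Q m v) - value Q m (value P l v) =
      (s * l - m + t) • value R (l + m) v) (m n : ℕ) (v : V) :
    mode P (m + 1) (mode Q n v) - mode Q n (mode P (m + 1) v) =
      (s * (n + m).choose m - (n + m).choose (m + 1) : ℂ) • mode R (n + m) v +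
        (t * (n + m + 1).choose (m + 1) : ℂ) • mode R (n + m + 1) v := by
  have h₁ : ∀ l, mode Q n (value P l v) - value P l (mode Q n v) =
      coeffAt n (lam V (shift l (R v)) - (s * l + t) • shift l (R v)) := fun l => by
    refine mode_apply_sub (fun m => ?_) n
    rw [← neg_sub, h, map_sub, map_smul, evalAt_lam, evalAt_shift, ← neg_smul, ← sub_smul]
    congr 1
    ring
  have h₂ : ∀ l, value P l (mode Q n v) - mode Q n (value P l v) =
      (s * l + t) • evalAt l (hasse n (R v)) - coeffAt n (lam V (shift l (R v))) := fun l => by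
    rw [← neg_sub, h₁, map_sub, map_smul, coeffAt_shift, neg_sub]
  cases n with
  | zero =>
    have h₃ := mode_apply_sub (A := P) (f := mode Q 0) (v := v)
      (w := s • lam V (hasse 0 (R v)) + t • hasse 0 (R v)) (fun l => by
        rw [h₂, coeffAt_lam_zero, map_add, map_smul, map_smul, evalAt_lam, smul_smul, add_smul,
          sub_zero]) (m + 1)
    rw [h₃, map_add, map_smul, map_smul, coeffAt_lam_succ, coeffAt_hasse, coeffAt_hasse]
    simp [mode]
  | succ n =>
    have h₃ := mode_apply_sub (A := P) (f := mode Q (n + 1)) (v := v)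
      (w := s • lam V (hasse (n + 1) (R v)) + t • hasse (n + 1) (R v) - hasse n (R v))
      (fun l => by
        rw [h₂, coeffAt_lam_succ, coeffAt_shift, map_sub, map_add, map_smul, map_smul,
          evalAt_lam, smul_smul, add_smul]) (m + 1)
    rw [h₃, map_sub, map_add, map_smul, map_smul, coeffAt_lam_succ, coeffAt_hasse,
      coeffAt_hasse, coeffAt_hasse,
      Nat.choose_symm_of_eq_add (show m + (n + 1) = (n + 1) + m by omega),
      Nat.choose_symm_of_eq_add (show m + 1 + (n + 1) = (n + 1) + (m + 1) by omega),
      Nat.choose_symm_of_eq_add (show m + 1 + n = n + (m + 1) by omega),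
      show m + (n + 1) = n + 1 + m by omega, show m + 1 + (n + 1) = n + 1 + m + 1 by omega,
      show m + 1 + n = n + 1 + m by omega]
    simp only [mode, LinearMap.comp_apply]
    module

end Modes

/-! ### Conformally linear maps -/

section Semilinear

variable {V : Type*} [AddCommGroup V] [Module ℂ V] [Module ℂ[X] V] [IsScalarTower ℂ ℂ[X] V]

/-- A `ℂ`-linear map `A : v ↦ A_λ v` is conformally linear if `A_λ ∂ = (∂ + λ) A_λ`. -/
def IsConformalLinear (A : V →ₗ[ℂ] ℂ[X] ⊗[ℂ] V) : Prop :=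
  ∀ (l : ℂ) (v : V), value A l ((X : ℂ[X]) • v) = (X + C l : ℂ[X]) • value A l v

namespace IsConformalLinear

variable {A : V →ₗ[ℂ] ℂ[X] ⊗[ℂ] V}

lemma value_X_smul (hA : IsConformalLinear A) (l : ℂ) (v : V) :
    value A l ((X : ℂ[X]) • v) = (X : ℂ[X]) • value A l v + l • value A l v := by
  rw [hA, add_smul, C_smul_eq]

lemma value_smul (hA : IsConformalLinear A) (l : ℂ) (p : ℂ[X]) (v : V) :
    value A l (p • v) = p.comp (X + C l) • value A l v := by
  induction p using Polynomial.induction_on' with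
  | add p q hp hq => rw [add_smul, map_add, hp, hq, add_comp, add_smul]
  | monomial n c =>
    induction n with
    | zero => rw [monomial_zero_left, C_comp, C_smul_eq, C_smul_eq, map_smul]
    | succ n ih =>
      rw [← C_mul_X_pow_eq_monomial] at ih ⊢
      have : (C c * X ^ (n + 1) : ℂ[X]) = X * (C c * X ^ n) := by ring
      rw [this, mul_smul, hA, ih, smul_smul, mul_comp (X : ℂ[X]), X_comp]

lemma apply_X_smul (hA : IsConformalLinear A) (v : V) :
    A ((X : ℂ[X]) • v) = del V (A v) + lam V (A v) := by
  refine ext_evalAt fun l => ?_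
  rw [map_add, evalAt_lam, evalAt, subst_del]
  exact hA.value_X_smul l v

lemma mode_X_smul_succ (hA : IsConformalLinear A) (n : ℕ) (v : V) :
    mode A (n + 1) ((X : ℂ[X]) • v) = (X : ℂ[X]) • mode A (n + 1) v + mode A n v := by
  simp only [mode, LinearMap.comp_apply, hA.apply_X_smul, map_add, coeffAt_del, coeffAt_lam_succ]

lemma mode_X_pow_smul (hA : IsConformalLinear A) {k : ℕ} {v : V} (hv : v ∈ lowDegree A (k + 1))
    (j : ℕ) : (∀ n ≥ j + k + 1, mode A n ((X ^ j : ℂ[X]) • v) = 0) ∧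
      mode A (j + k) ((X ^ j : ℂ[X]) • v) = mode A k v := by
  induction j with
  | zero => simpa using mem_lowDegree.1 hv
  | succ j ih =>
    obtain ⟨h₁, h₂⟩ := ih
    rw [pow_succ', mul_smul]
    constructor
    · intro n hn
      obtain ⟨n, rfl⟩ : ∃ n', n = n' + 1 := ⟨n - 1, by omega⟩
      rw [hA.mode_X_smul_succ, h₁ _ (by omega), h₁ _ (by omega), smul_zero, add_zero]
    · rw [add_right_comm, hA.mode_X_smul_succ, h₁ _ (by omega), h₂, smul_zero, zero_add]

/-- The top coefficient of `A_λ (p(∂) v) = p(∂ + λ) A_λ v`. -/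
lemma mode_smul (hA : IsConformalLinear A) {k : ℕ} {v : V} (hv : v ∈ lowDegree A (k + 1))
    {p : ℂ[X]} {d : ℕ} (hp : p.natDegree ≤ d) :
    mode A (d + k) (p • v) = p.coeff d • mode A k v := by
  conv_lhs => rw [p.as_sum_range' (d + 1) (by omega), Finset.sum_smul]
  rw [map_sum, Finset.sum_range_succ, Finset.sum_eq_zero]
  · rw [← C_mul_X_pow_eq_monomial, mul_smul, C_smul_eq, map_smul, (hA.mode_X_pow_smul hv d).2,
      zero_add]
  · intro j hj
    have hj := Finset.mem_range.1 hj
    rw [← C_mul_X_pow_eq_monomial, mul_smul, C_smul_eq, map_smul,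
      (hA.mode_X_pow_smul hv j).1 _ (by omega), smul_zero]

/-- If no nonzero vector has degree less than `k`, then vectors of degree `k` are as independent
over `ℂ[∂]` as they are over `ℂ`: in a relation `∑ pᵢ(∂) vᵢ = 0` with the `pᵢ` of degree at
most `d`, the coefficient of `λ ^ (d + k)` of `A_λ` is `A_(k) ∑ cᵢ vᵢ`, with `cᵢ` the coefficient
of degree `d` of `pᵢ`. -/
lemma linearIndependent (hA : IsConformalLinear A) {k : ℕ} (hk : lowDegree A k = ⊥)
    {ι : Type*} {v : ι → V} (hv : ∀ i, v i ∈ lowDegree A (k + 1))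
    (hi : LinearIndependent ℂ v) : LinearIndependent ℂ[X] v := by
  rw [linearIndependent_iff'] at hi ⊢
  intro s p hp
  have key : ∀ d, (∀ i ∈ s, (p i).natDegree ≤ d) → ∀ i ∈ s, (p i).coeff d = 0 := by
    intro d hd
    refine hi s _ (eq_zero_of_mode_eq_zero hk
      (Submodule.sum_mem _ fun i _ => Submodule.smul_mem _ _ (hv i)) ?_)
    have := congrArg (mode A (d + k)) hp
    rw [map_sum, map_zero] at this
    rw [map_sum, ← this]
    refine Finset.sum_congr rfl fun i his => ?_
    rw [map_smul, hA.mode_smul (hv i) (hd i his)]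
  have down : ∀ d, (∀ i ∈ s, (p i).natDegree ≤ d) → ∀ i ∈ s, p i = 0 := by
    intro d
    induction d with
    | zero =>
      intro hd i his
      rw [eq_C_of_natDegree_le_zero (hd i his), key 0 hd i his, C_0]
    | succ d ih =>
      intro hd
      refine ih fun i his => Nat.le_of_lt_succ ((hd i his).lt_of_ne fun h => ?_)
      have h0 := key _ hd i his
      rw [← h] at h0
      have : p i = 0 := leadingCoeff_eq_zero.1 h0
      simp [this] at h
  exact down (s.sup fun i => (p i).natDegree) fun i his =>
    Finset.le_sup (f := fun i => (p i).natDegree) his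

lemma finiteDimensional (hA : IsConformalLinear A) [Module.Finite ℂ[X] V] {k : ℕ}
    (hk : lowDegree A k = ⊥) : FiniteDimensional ℂ (lowDegree A (k + 1)) := by
  have b := Module.Basis.ofVectorSpace ℂ (lowDegree A (k + 1))
  have hi : LinearIndependent ℂ fun i => (b i : V) :=
    b.linearIndependent.map' (lowDegree A (k + 1)).subtype (Submodule.ker_subtype _)
  have := (hA.linearIndependent hk (fun i => (b i).2) hi).finite_of_isNoetherian
  exact Module.Finite.of_basis b

lemma smul_eq_zero (hA : IsConformalLinear A) {k : ℕ} (hk : lowDegree A k = ⊥) {v : V}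
    (hv : v ∈ lowDegree A (k + 1)) (hv0 : v ≠ 0) {p : ℂ[X]} (hp : p • v = 0) : p = 0 := by
  have hi : LinearIndependent ℂ fun _ : Unit => v := LinearIndependent.of_subsingleton () hv0
  have := hA.linearIndependent hk (fun _ => hv) hi
  rw [linearIndependent_iff'] at this
  exact this Finset.univ (fun _ => p) (by simpa using hp) () (Finset.mem_univ _)

end IsConformalLinear

end Semilinear

/-! ### Commutators on finite-dimensional spaces -/

section FiniteDimensional

variable {V : Type*} [AddCommGroup V] [Module ℂ V]

/-- If `[A, B] = c N` on a nonzero finite-dimensional space, with `N` injective and commuting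
with `A`, then `[A, B N⁻¹] = c`, which has trace zero. -/
lemma eq_zero_of_commutator {W : Submodule ℂ V} [FiniteDimensional ℂ W] (hW : W ≠ ⊥)
    {A B N : Module.End ℂ V} {c : ℂ} (hA : ∀ w ∈ W, A w ∈ W) (hB : ∀ w ∈ W, B w ∈ W)
    (hN : ∀ w ∈ W, N w ∈ W) (hinj : ∀ w ∈ W, N w = 0 → w = 0)
    (hAN : ∀ w ∈ W, A (N w) = N (A w)) (hAB : ∀ w ∈ W, A (B w) - B (A w) = c • N w) :
    c = 0 := by
  have : Nontrivial W := Submodule.nontrivial_iff_ne_bot.2 hW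
  let A' := A.restrict hA
  let B' := B.restrict hB
  let N' := N.restrict hN
  have hN' : IsUnit N' := by
    rw [LinearMap.isUnit_iff_ker_eq_bot, LinearMap.ker_eq_bot']
    intro w hw
    exact Subtype.ext (hinj w w.2 (congrArg Subtype.val hw))
  obtain ⟨u, hu⟩ := hN'
  have hcomm : Commute A' (u : Module.End ℂ W) := by
    rw [hu]
    exact LinearMap.ext fun w => Subtype.ext (hAN w w.2)
  have hbr : A' * B' - B' * A' = c • (u : Module.End ℂ W) := by
    rw [hu]
    exact LinearMap.ext fun w => Subtype.ext (hAB w w.2)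
  have hinv : A' * ↑u⁻¹ = ↑u⁻¹ * A' := hcomm.units_inv_right
  have h1 : A' * (B' * ↑u⁻¹) - (B' * ↑u⁻¹) * A' = c • 1 := by
    rw [mul_assoc B', ← hinv, ← mul_assoc, ← mul_assoc, ← sub_mul, hbr, smul_mul_assoc,
      Units.mul_inv]
  have h2 := congrArg (LinearMap.trace ℂ W) h1
  rw [map_sub, LinearMap.trace_mul_comm, sub_self, map_smul, LinearMap.trace_one,
    smul_eq_mul] at h2
  exact (mul_eq_zero.1 h2.symm).resolve_right
    (Nat.cast_ne_zero.2 (Module.finrank_pos (R := ℂ) (M := W)).ne')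

lemma eq_zero_of_weight {W : Submodule ℂ V} [FiniteDimensional ℂ W] (hW : W ≠ ⊥)
    {B N : Module.End ℂ V} {c : ℂ} (hB : ∀ w ∈ W, B w ∈ W) (hN : ∀ w ∈ W, N w ∈ W)
    (hinj : ∀ w ∈ W, N w = 0 → w = 0) (hBN : ∀ w ∈ W, B (N w) - N (B w) = c • N w) : c = 0 :=
  eq_zero_of_commutator hW (A := N) (B := -B) hN (fun w hw => neg_mem (hB w hw)) hN hinj
    (fun _ _ => rfl) fun w hw => by
      rw [← hBN w hw, LinearMap.neg_apply, LinearMap.neg_apply, map_neg]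
      abel

lemma exists_eigenvector {W : Submodule ℂ V} [FiniteDimensional ℂ W] (hW : W ≠ ⊥)
    {A : Module.End ℂ V} (hA : ∀ w ∈ W, A w ∈ W) :
    ∃ c : ℂ, W ⊓ LinearMap.ker (A - c • 1) ≠ ⊥ := by
  have : Nontrivial W := Submodule.nontrivial_iff_ne_bot.2 hW
  obtain ⟨c, hc⟩ := Module.End.exists_eigenvalue (A.restrict hA)
  obtain ⟨w, hw⟩ := hc.exists_hasEigenvector
  refine ⟨c, (Submodule.ne_bot_iff _).2 ⟨w, ⟨w.2, ?_⟩, fun h => hw.2 (Subtype.ext h)⟩⟩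
  have := congrArg Subtype.val hw.apply_eq_smul
  simpa [sub_eq_zero] using this

/-- Three pairwise commuting operators on a nonzero finite-dimensional space have a common
eigenvector. -/
lemma exists_common_eigenvector {W : Submodule ℂ V} [FiniteDimensional ℂ W] (hW : W ≠ ⊥)
    {A B D : Module.End ℂ V} (hA : ∀ w ∈ W, A w ∈ W) (hB : ∀ w ∈ W, B w ∈ W)
    (hD : ∀ w ∈ W, D w ∈ W) (hAB : ∀ w ∈ W, A (B w) = B (A w))
    (hAD : ∀ w ∈ W, A (D w) = D (A w)) (hBD : ∀ w ∈ W, B (D w) = D (B w)) :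
    ∃ w ∈ W, w ≠ 0 ∧ ∃ x y z : ℂ, A w = x • w ∧ B w = y • w ∧ D w = z • w := by
  have stable : ∀ {P Q : Module.End ℂ V} {U : Submodule ℂ V} (c : ℂ), U ≤ W →
      (∀ w ∈ U, Q w ∈ U) → (∀ w ∈ W, P (Q w) = Q (P w)) →
      ∀ w ∈ U ⊓ LinearMap.ker (P - c • 1), Q w ∈ U ⊓ LinearMap.ker (P - c • 1) := by
    rintro P Q U c hUW hQ hPQ w ⟨hw, hw'⟩
    refine ⟨hQ w hw, ?_⟩
    have : P w = c • w := by simpa [sub_eq_zero] using hw'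
    simp [hPQ w (hUW hw), this]
  obtain ⟨x, hx⟩ := exists_eigenvector hW hA
  have : FiniteDimensional ℂ ↥(W ⊓ LinearMap.ker (A - x • 1)) :=
    Submodule.finiteDimensional_of_le inf_le_left
  obtain ⟨y, hy⟩ := exists_eigenvector hx (stable x le_rfl hB hAB)
  have : FiniteDimensional ℂ ↥(W ⊓ LinearMap.ker (A - x • 1) ⊓ LinearMap.ker (B - y • 1)) :=
    Submodule.finiteDimensional_of_le inf_le_left
  obtain ⟨z, hz⟩ := exists_eigenvector hy
    (stable y inf_le_left (stable x le_rfl hD hAD) hBD)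
  obtain ⟨w, ⟨⟨⟨hw, hwx⟩, hwy⟩, hwz⟩, hw0⟩ := (Submodule.ne_bot_iff _).1 hz
  refine ⟨w, hw, hw0, x, y, z, ?_, ?_, ?_⟩
  · simpa [sub_eq_zero] using hwx
  · simpa [sub_eq_zero] using hwy
  · simpa [sub_eq_zero] using hwz

end FiniteDimensional

/-! ### The brackets of the generators -/

section Algebra

/-- The brackets of the generators which `TSV(a,b)` and `TSV(c)` have in common:
`[L_λ L] = (∂ + 2λ) L`, `[L_λ Y] = (∂ + aλ + b) Y`, `[L_λ M] = (∂ + dλ + e) M`,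
`[Y_λ Y] = (∂ + 2λ) g(∂) M`, `[Y_λ M] = 0`, for a nonzero polynomial `g`. -/
structure HasTSVBrackets (A : LieConformalAlgebra Free3) (a b d e : ℂ) (g : ℂ[X]) : Prop where
  bracket_L_L : ∀ l, evalAt l (A.bracket vecL vecL) = (X + C (2 * l) : ℂ[X]) • vecL
  bracket_L_Y : ∀ l, evalAt l (A.bracket vecL vecY) = (X + C (a * l + b) : ℂ[X]) • vecY
  bracket_L_M : ∀ l, evalAt l (A.bracket vecL vecM) = (X + C (d * l + e) : ℂ[X]) • vecM
  bracket_Y_Y : ∀ l, evalAt l (A.bracket vecY vecY) = ((X + C (2 * l)) * g : ℂ[X]) • vecM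
  bracket_Y_M : ∀ l, evalAt l (A.bracket vecY vecM) = 0
  ne_zero : g ≠ 0

lemma hasTSVBrackets_TSV (a b : ℂ) :
    HasTSVBrackets (TSV a b) a b (2 * (a - 1)) (2 * b) 1 := by
  constructor
  case ne_zero => exact one_ne_zero
  all_goals
    intro l
    have e2 : (C 2 : ℂ[X]) = 2 := map_ofNat C 2
    simp only [evalAt, TSV, subst_tsv]
    ext1 k
    fin_cases k <;> simp [vecL, vecY, vecM, add_assoc, e2]

lemma hasTSVBrackets_TSVc (c : ℂ) :
    HasTSVBrackets (TSVc c) (3 / 2) c 0 (2 * c) (-X - C (2 * c)) := by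
  constructor
  case ne_zero =>
    intro h
    have := congrArg (fun p => p.coeff 1) h
    simp [coeff_X] at this
  all_goals
    intro l
    have e2 : (C 2 : ℂ[X]) = 2 := map_ofNat C 2
    simp only [evalAt, TSVc, subst_tsvc]
    ext1 k
    fin_cases k <;> simp [vecL, vecY, vecM, add_assoc, e2]

lemma eq_sum_gen (f : Free3) : f = f 0 • vecL + f 1 • vecY + f 2 • vecM := by
  ext1 k
  fin_cases k <;> simp [vecL, vecY, vecM]

end Algebra

/-! ### The action of the generators -/

namespace ConformalModule

variable {A : LieConformalAlgebra Free3} {V : Type*} [AddCommGroup V] [Module ℂ V]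
  [Module ℂ[X] V] [IsScalarTower ℂ ℂ[X] V] (E : ConformalModule A V)

lemma isConformalLinear_act (x : Free3) : IsConformalLinear (E.act x) :=
  fun l v => E.act_del l x v

lemma value_act_smul (l : ℂ) (p : ℂ[X]) (x : Free3) (v : V) :
    value (E.act (p • x)) l v = p.eval (-l) • value (E.act x) l v := by
  induction p using Polynomial.induction_on' with
  | add p q hp hq =>
    simp only [value, LinearMap.comp_apply] at *
    rw [add_smul, map_add, LinearMap.add_apply, map_add, hp, hq, eval_add, add_smul]
  | monomial n c =>
    induction n with
    | zero =>
      simp only [value, LinearMap.comp_apply]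
      rw [monomial_zero_left, C_smul_eq, map_smul, LinearMap.smul_apply, map_smul, eval_C]
    | succ n ih =>
      rw [← C_mul_X_pow_eq_monomial] at ih ⊢
      have : (C c * X ^ (n + 1) : ℂ[X]) = X * (C c * X ^ n) := by ring
      rw [this, mul_smul X, eval_mul, mul_smul (eval (-l) X), ← ih]
      simp only [value, LinearMap.comp_apply, E.del_act, eval_X, neg_smul]

lemma value_act (l : ℂ) (f : Free3) (v : V) :
    value (E.act f) l v = (f 0).eval (-l) • value (E.act vecL) l v +
      (f 1).eval (-l) • value (E.act vecY) l v + (f 2).eval (-l) • value (E.act vecM) l v := by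
  rw [← value_act_smul, ← value_act_smul, ← value_act_smul]
  conv_lhs => rw [eq_sum_gen f]
  simp only [value, LinearMap.comp_apply, map_add, LinearMap.add_apply]

/-- It suffices to check that a `ℂ[∂]`-submodule is conformal on the generators. -/
lemma isConformalSubmodule_of_gen {S : Submodule ℂ[X] V}
    (hL : ∀ v ∈ S, ∀ l, value (E.act vecL) l v ∈ S)
    (hY : ∀ v ∈ S, ∀ l, value (E.act vecY) l v ∈ S)
    (hM : ∀ v ∈ S, ∀ l, value (E.act vecM) l v ∈ S) : E.IsConformalSubmodule S := by
  intro f v hv l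
  change value (E.act f) l v ∈ S
  rw [value_act, ← C_smul_eq, ← C_smul_eq, ← C_smul_eq]
  exact S.add_mem (S.add_mem (S.smul_mem _ (hL v hv l)) (S.smul_mem _ (hY v hv l)))
    (S.smul_mem _ (hM v hv l))

variable {E} {a b d e : ℂ} {g : ℂ[X]}

lemma act_act_value (l m : ℂ) (x y : Free3) (v : V) :
    value (E.act x) l (value (E.act y) m v) - value (E.act y) m (value (E.act x) l v) =
      value (E.act (evalAt l (A.bracket x y))) (l + m) v :=
  E.act_act l m x y v

section Relations

variable (hA : HasTSVBrackets A a b d e g)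
include hA

lemma comm_L_L (l m : ℂ) (v : V) :
    value (E.act vecL) l (value (E.act vecL) m v) - value (E.act vecL) m (value (E.act vecL) l v) =
      (1 * l - m + 0) • value (E.act vecL) (l + m) v := by
  rw [act_act_value, hA.bracket_L_L, value_act_smul]
  congr 1
  simp
  ring

lemma comm_L_Y (l m : ℂ) (v : V) :
    value (E.act vecL) l (value (E.act vecY) m v) - value (E.act vecY) m (value (E.act vecL) l v) =
      ((a - 1) * l - m + b) • value (E.act vecY) (l + m) v := by
  rw [act_act_value, hA.bracket_L_Y, value_act_smul]
  congr 1
  simp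
  ring

lemma comm_L_M (l m : ℂ) (v : V) :
    value (E.act vecL) l (value (E.act vecM) m v) - value (E.act vecM) m (value (E.act vecL) l v) =
      ((d - 1) * l - m + e) • value (E.act vecM) (l + m) v := by
  rw [act_act_value, hA.bracket_L_M, value_act_smul]
  congr 1
  simp
  ring

lemma comm_Y_Y (l m : ℂ) (v : V) :
    value (E.act vecY) l (value (E.act vecY) m v) - value (E.act vecY) m (value (E.act vecY) l v) =
      ((l - m) * g.eval (-(l + m))) • value (E.act vecM) (l + m) v := by
  rw [act_act_value, hA.bracket_Y_Y, value_act_smul]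
  congr 1
  simp only [eval_mul, eval_add, eval_X, eval_C]
  ring

lemma comm_M_Y (l m : ℂ) (v : V) :
    value (E.act vecM) l (value (E.act vecY) m v) =
      value (E.act vecY) m (value (E.act vecM) l v) := by
  have := act_act_value (E := E) m l vecY vecM v
  rw [hA.bracket_Y_M, map_zero] at this
  exact (sub_eq_zero.1 (this.trans (by simp [value]))).symm

end Relations

end ConformalModule

/-! ### Vectors of minimal degree -/

section Jump

variable {V : Type*} [AddCommGroup V] [Module ℂ V]

lemma eq_bot_or_exists_jump {U : ℕ → Submodule ℂ V}
    {k : ℕ} (hk : U k ≠ ⊥) : U 0 ≠ ⊥ ∨ ∃ j, U j = ⊥ ∧ U (j + 1) ≠ ⊥ := by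
  induction k with
  | zero => exact Or.inl hk
  | succ k ih =>
    by_cases h : U k = ⊥
    · exact Or.inr ⟨k, h, hk⟩
    · exact ih h

lemma lowDegree_jump [Nontrivial V] (A : V →ₗ[ℂ] ℂ[X] ⊗[ℂ] V) :
    lowDegree A 0 ≠ ⊥ ∨ ∃ k, lowDegree A k = ⊥ ∧ lowDegree A (k + 1) ≠ ⊥ := by
  obtain ⟨v, hv⟩ := exists_ne (0 : V)
  obtain ⟨k, hk⟩ := exists_mem_lowDegree A v
  exact eq_bot_or_exists_jump ((Submodule.ne_bot_iff _).2 ⟨v, hk, hv⟩)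

end Jump

/-! ### Weight vectors -/

section Weights

variable {V : Type*} [AddCommGroup V] [Module ℂ V] [Module ℂ[X] V] [IsScalarTower ℂ ℂ[X] V]
  {L Y M : V →ₗ[ℂ] ℂ[X] ⊗[ℂ] V}

/-- If `Y` and `M` commute and `[Y_λ, Y_0] = h(λ) M_λ` with `h ≠ 0`, then `M` kills a nonzero
vector. Otherwise, on the vectors of minimal degree `k` for `M`, the injective operator `M_(k)`
would be, up to a scalar, a commutator of coefficients of `Y`, with which it commutes. -/
lemma exists_killed_of_commutator [Nontrivial V] [Module.Finite ℂ[X] V]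
    (hM : IsConformalLinear M)
    (hYM : ∀ l m v, value M l (value Y m v) = value Y m (value M l v)) {h : ℂ[X]} (hh : h ≠ 0)
    (hYY : ∀ l v, value Y l (mode Y 0 v) - mode Y 0 (value Y l v) = h.eval l • value M l v) :
    lowDegree M 0 ≠ ⊥ := by
  rcases lowDegree_jump M with h0 | ⟨k, hk, hk1⟩
  · exact h0
  · have := hM.finiteDimensional hk
    have hcomm := mode_comm_of_value_comm hYM
    have hstab : ∀ n, ∀ w ∈ lowDegree M (k + 1), mode Y n w ∈ lowDegree M (k + 1) :=
      fun n w hw i hi => by rw [hcomm, hw i hi, map_zero]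
    have hbr : ∀ w ∈ lowDegree M (k + 1), mode Y (h.natDegree + k) (mode Y 0 w) -
        mode Y 0 (mode Y (h.natDegree + k) w) = h.leadingCoeff • mode M k w := fun w hw => by
      rw [mode_apply_sub (w := mulPoly h (M w)) (fun l => by rw [hYY, evalAt_mulPoly]; rfl),
        coeffAt_mulPoly_top h hw]
      rfl
    have hlc := leadingCoeff_ne_zero.2 hh
    -- `M_(k)` preserves the space because it is a multiple of the commutator.
    have hMW : ∀ w ∈ lowDegree M (k + 1), mode M k w ∈ lowDegree M (k + 1) := fun w hw => by
      rw [← Submodule.smul_mem_iff _ hlc, ← hbr w hw]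
      exact sub_mem (hstab _ _ (hstab _ _ hw)) (hstab _ _ (hstab _ _ hw))
    exact absurd (eq_zero_of_commutator hk1 (hstab _) (hstab _) hMW
      (fun w hw h0 => eq_zero_of_mode_eq_zero hk hw h0) (fun w _ => (hcomm _ _ _).symm) hbr) hlc

/-- The operator `L_0 - ∂`. -/
def twist (L : V →ₗ[ℂ] ℂ[X] ⊗[ℂ] V) : Module.End ℂ V :=
  mode L 0 - Algebra.lsmul ℂ ℂ V (X : ℂ[X])

lemma twist_apply (v : V) : twist L v = mode L 0 v - (X : ℂ[X]) • v := rfl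

/-- If `[L_λ, Q_μ] = (s λ - μ + t) Q_{λ + μ}`, then `[L_0 - ∂, Q_μ] = t Q_μ`. -/
lemma twist_mode {Q : V →ₗ[ℂ] ℂ[X] ⊗[ℂ] V} {s t : ℂ} (hQ : IsConformalLinear Q)
    (h : ∀ l m v, value L l (value Q m v) - value Q m (value L l v) =
      (s * l - m + t) • value Q (l + m) v) (n : ℕ) (v : V) :
    twist L (mode Q n v) - mode Q n (twist L v) = t • mode Q n v := by
  have key : mode Q n (twist L v) - twist L (mode Q n v) = coeffAt n (-(t • Q v)) := by
    refine mode_apply_sub (fun l => ?_) n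
    have h0 := h 0 l v
    rw [value_zero, zero_add, sub_eq_iff_eq_add] at h0
    rw [twist_apply, twist_apply, map_sub, hQ.value_X_smul, h0, map_neg, map_smul]
    change _ = -(t • value Q l v)
    module
  rw [← neg_sub, key, map_neg, neg_neg, map_smul]
  rfl

/-- An abelian `Y` with `[L_λ, Y_μ] = ((a - 1) λ - μ + b) Y_{λ + μ}` kills a nonzero vector,
unless `(a, b) = (1, 0)` and there are vectors of degree zero for `Y`. Indeed, if `k` is the
minimal degree, then on the vectors of degree `k` the injective operator `Y_(k)` is, up to the
scalars `b`, `a - 1 - k` and `k (k + 1) / 2`, a commutator with `L_0 - ∂`, with `L_(1)`, and of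
`L_(2)` with `Y_(k - 1)`. -/
lemma exists_killed_or_degree_zero [Nontrivial V] [Module.Finite ℂ[X] V]
    (hY : IsConformalLinear Y) {a b : ℂ}
    (hLY : ∀ l m v, value L l (value Y m v) - value Y m (value L l v) =
      ((a - 1) * l - m + b) • value Y (l + m) v)
    (hYY : ∀ l m v, value Y l (value Y m v) = value Y m (value Y l v)) :
    lowDegree Y 0 ≠ ⊥ ∨ (a = 1 ∧ b = 0 ∧ lowDegree Y 0 = ⊥ ∧ lowDegree Y 1 ≠ ⊥) := by
  rcases lowDegree_jump Y with h0 | ⟨k, hk, hk1⟩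
  · exact Or.inl h0
  have := hY.finiteDimensional hk
  have hyy := mode_comm_of_value_comm hYY
  have hyW : ∀ n, ∀ w ∈ lowDegree Y (k + 1), mode Y n w ∈ lowDegree Y (k + 1) :=
    fun n w hw i hi => by rw [hyy, hw i hi, map_zero]
  have hinj : ∀ w ∈ lowDegree Y (k + 1), mode Y k w = 0 → w = 0 :=
    fun w hw h0 => eq_zero_of_mode_eq_zero hk hw h0
  have hTW : ∀ w ∈ lowDegree Y (k + 1), twist L w ∈ lowDegree Y (k + 1) := fun w hw i hi => by
    have := twist_mode hY hLY i w
    rw [hw i hi, map_zero, zero_sub, smul_zero, neg_eq_zero] at this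
    exact this
  have hlW : ∀ m, ∀ w ∈ lowDegree Y (k + 1), mode L (m + 1) w ∈ lowDegree Y (k + 1) :=
    fun m w hw i hi => by
      have := mode_comm hLY m i w
      rw [hw i hi, hw (i + m) (by omega), hw (i + m + 1) (by omega), map_zero, zero_sub,
        smul_zero, smul_zero, add_zero, neg_eq_zero] at this
      exact this
  have hb : b = 0 :=
    eq_zero_of_weight hk1 hTW (hyW k) hinj fun w _ => twist_mode hY hLY k w
  have ha : a - 1 - k = 0 := by
    refine eq_zero_of_weight hk1 (hlW 0) (hyW k) hinj fun w _ => ?_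
    rw [mode_comm hLY 0 k w, hb]
    simp
  replace ha : a = k + 1 := by linear_combination ha
  cases k with
  | zero => exact Or.inr ⟨by simpa using ha, hb, hk, hk1⟩
  | succ k =>
    exfalso
    have hchoose : ((k + 1).choose 2 : ℂ) = (k + 1) * k / 2 := by
      rw [Nat.cast_choose_two]; push_cast; ring
    have := eq_zero_of_commutator (A := mode L 2) (B := mode Y k) (N := mode Y (k + 1))
      (c := (k + 1) * (k + 2) / 2) hk1 (hlW 1) (hyW k) (hyW _) hinj
      (fun w hw => by
        have := mode_comm hLY 1 (k + 1) w
        rw [hw (k + 1 + 1) le_rfl, hw (k + 1 + 1 + 1) (by omega), smul_zero, smul_zero, add_zero,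
          sub_eq_zero] at this
        exact this)
      fun w _ => by
        have := mode_comm hLY 1 k w
        rw [this, hb, zero_mul, zero_smul, add_zero, Nat.choose_one_right, hchoose, ha]
        congr 1
        push_cast
        ring
    have h1 : ((k : ℂ) + 1) * (k + 2) / 2 ≠ 0 := by
      have : ((k : ℂ) + 1) * (k + 2) / 2 = (((k + 1) * (k + 2) : ℕ) : ℂ) / 2 := by push_cast; ring
      rw [this]
      exact div_ne_zero (Nat.cast_ne_zero.2 (by positivity)) two_ne_zero
    exact h1 this

/-- A common eigenvector for `L_λ` and `Y_λ`, of degree at most one for `L` and zero for `Y`,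
which generates a free `ℂ[∂]`-module. Among the vectors of degree zero for `Y`, take those of
minimal degree `K` for `L`. The degree is at most one, since otherwise `L_(K)` would be injective
on them in spite of `[L_(1), L_(K)] = (1 - K) L_(K)`. On them `L_0 - ∂`, `L_(1)` and `Y_(0)`
commute. -/
lemma exists_common_weight_vector [Nontrivial V] [Module.Finite ℂ[X] V]
    (hL : IsConformalLinear L) (hY : IsConformalLinear Y)
    (hLL : ∀ l m v, value L l (value L m v) - value L m (value L l v) =
      (1 * l - m + 0) • value L (l + m) v)
    (hLY : ∀ l m v, value L l (value Y m v) - value Y m (value L l v) =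
      (0 * l - m + 0) • value Y (l + m) v)
    (hYY : ∀ l m v, value Y l (value Y m v) = value Y m (value Y l v))
    (h : (Y = 0 ∧ lowDegree L 0 = ⊥) ∨ (lowDegree Y 0 = ⊥ ∧ lowDegree Y 1 ≠ ⊥)) :
    ∃ v : V, v ≠ 0 ∧ (∀ p : ℂ[X], p • v = 0 → p = 0) ∧ ∃ α β γ : ℂ,
      (∀ l, value L l v = (X + C α * C l + C β : ℂ[X]) • v) ∧ ∀ l, value Y l v = γ • v := by
  have hU : lowDegree Y 1 ≠ ⊥ := by
    rcases h with ⟨rfl, -⟩ | ⟨-, h⟩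
    · obtain ⟨v, hv⟩ := exists_ne (0 : V)
      exact (Submodule.ne_bot_iff _).2 ⟨v, fun _ _ => by simp [mode], hv⟩
    · exact h
  let W : ℕ → Submodule ℂ V := fun k => lowDegree Y 1 ⊓ lowDegree L k
  have hjump : W 0 ≠ ⊥ ∨ ∃ k, W k = ⊥ ∧ W (k + 1) ≠ ⊥ := by
    obtain ⟨v, hv, hv0⟩ := (Submodule.ne_bot_iff _).1 hU
    obtain ⟨k, hk⟩ := exists_mem_lowDegree L v
    exact eq_bot_or_exists_jump (k := k) ((Submodule.ne_bot_iff _).2 ⟨v, ⟨hv, hk⟩, hv0⟩)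
  have hlY : ∀ m, ∀ w ∈ lowDegree Y 1, mode L (m + 1) w ∈ lowDegree Y 1 := fun m w hw i hi => by
    have := mode_comm hLY m i w
    rw [hw i hi, hw (i + m) (by omega), hw (i + m + 1) (by omega), map_zero, zero_sub,
      smul_zero, smul_zero, add_zero, neg_eq_zero] at this
    exact this
  have hlW : ∀ k m, ∀ w ∈ W k, mode L (m + 1) w ∈ W k := fun k m w hw => by
    refine ⟨hlY m w hw.1, fun i hi => ?_⟩
    have := mode_comm hLL m i w
    rw [hw.2 i hi, hw.2 (i + m) (by omega), hw.2 (i + m + 1) (by omega), map_zero, zero_sub,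
      smul_zero, smul_zero, add_zero, neg_eq_zero] at this
    exact this
  have hTL := twist_mode hL hLL
  have hTY := twist_mode hY hLY
  simp only [zero_smul, sub_eq_zero] at hTL hTY
  have hTW : ∀ k, ∀ w ∈ W k, twist L w ∈ W k := fun k w hw =>
    ⟨fun i hi => by rw [← hTY, hw.1 i hi, map_zero], fun i hi => by
      rw [← hTL, hw.2 i hi, map_zero]⟩
  -- The vectors of minimal degree. Their space lies in one to which
  -- `IsConformalLinear.linearIndependent` applies, for `L` if `Y = 0` and for `Y` otherwise.
  obtain ⟨k, hk, hWk, hfin, htf⟩ : ∃ k ≤ 2, W k ≠ ⊥ ∧ FiniteDimensional ℂ (W k) ∧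
      ∀ w ∈ W k, w ≠ 0 → ∀ p : ℂ[X], p • w = 0 → p = 0 := by
    have hgood : ∀ k, W k ≠ ⊥ → (k = 0 ∨ W (k - 1) = ⊥) → FiniteDimensional ℂ (W k) ∧
        ∀ w ∈ W k, w ≠ 0 → ∀ p : ℂ[X], p • w = 0 → p = 0 := by
      intro k hWk hk
      rcases h with ⟨rfl, hL0⟩ | ⟨hY0, -⟩
      · have hW : ∀ k, W k = lowDegree L k := fun k =>
          inf_eq_right.2 fun v _ _ _ => by simp [mode]
        cases k with
        | zero => exact absurd ((hW 0).trans hL0) hWk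
        | succ k =>
          have hk' : lowDegree L k = ⊥ := by
            rw [← hW]; exact hk.resolve_left (by omega)
          rw [hW]
          exact ⟨hL.finiteDimensional hk', fun w hw hw0 p => hL.smul_eq_zero hk' hw hw0⟩
      · have := hY.finiteDimensional hY0
        exact ⟨Submodule.finiteDimensional_of_le (S₂ := lowDegree Y (0 + 1)) inf_le_left,
          fun w hw hw0 p => hY.smul_eq_zero hY0 hw.1 hw0⟩
    rcases hjump with h0 | ⟨k, hk, hk1⟩
    · exact ⟨0, by omega, h0, hgood 0 h0 (Or.inl rfl)⟩
    · have hg := hgood (k + 1) hk1 (Or.inr hk)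
      refine ⟨k + 1, ?_, hk1, hg⟩
      by_contra! hlt
      obtain ⟨k, rfl⟩ : ∃ k', k = k' + 2 := ⟨k - 2, by omega⟩
      have := hg.1
      have hc := eq_zero_of_weight (c := -(k + 1 : ℂ)) hk1 (hlW _ 0) (hlW _ (k + 1))
        (fun w hw h0 => by
          rw [← Submodule.mem_bot ℂ, ← hk]
          refine ⟨hw.1, fun i hi => ?_⟩
          rcases hi.eq_or_lt with rfl | hlt
          · exact h0
          · exact hw.2 i hlt)
        fun w _ => by
          rw [mode_comm hLL 0 (k + 1 + 1) w]
          simp only [zero_mul, zero_smul, add_zero, zero_add, Nat.choose_zero_right,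
            Nat.choose_one_right]
          congr 1
          push_cast
          ring
      exact (Nat.cast_add_one_ne_zero k) (neg_eq_zero.1 hc)
  have hly : ∀ m w, mode L m (mode Y 0 w) = mode Y 0 (mode L m w) := fun m w => by
    cases m with
    | zero =>
      have := hLY 0 0 w
      rw [value_zero, value_zero] at this
      simpa [sub_eq_zero] using this
    | succ m =>
      have := mode_comm hLY m 0 w
      simpa [sub_eq_zero] using this
  have hyW : ∀ w ∈ W k, mode Y 0 w ∈ W k := fun w hw =>
    ⟨fun i hi => by rw [mode_comm_of_value_comm hYY, hw.1 i hi, map_zero],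
      fun i hi => by rw [hly, hw.2 i hi, map_zero]⟩
  obtain ⟨v, hv, hv0, β, α, γ, h1, h2, h3⟩ := exists_common_eigenvector hWk (hTW k) (hlW k 0) hyW
    (fun w _ => hTL 1 w) (fun w _ => hTY 0 w) (fun w _ => hly 1 w)
  refine ⟨v, hv0, htf v hv hv0, α, β, γ, fun l => ?_, fun l => ?_⟩
  · rw [twist_apply, sub_eq_iff_eq_add] at h1
    have : value L l v = ∑ n ∈ Finset.range 2, l ^ n • mode L n v :=
      evalAt_eq_sum l fun n hn => hv.2 n (hk.trans hn)
    rw [this, Finset.sum_range_succ, Finset.sum_range_one, h1, h2, add_smul, add_smul, mul_smul,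
      C_smul_eq, C_smul_eq, C_smul_eq]
    module
  · have : value Y l v = ∑ n ∈ Finset.range 1, l ^ n • mode Y n v :=
      evalAt_eq_sum l fun n hn => hv.1 n hn
    rw [this, Finset.sum_range_one, h3, pow_zero, one_smul]

end Weights

/-! ### Irreducible modules -/

section Kernel

variable {V : Type*} [AddCommGroup V] [Module ℂ V] [Module ℂ[X] V] [IsScalarTower ℂ ℂ[X] V]

/-- The vectors killed by a conformally linear map form a `ℂ[∂]`-submodule. -/
def IsConformalLinear.kernel {A : V →ₗ[ℂ] ℂ[X] ⊗[ℂ] V} (hA : IsConformalLinear A) :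
    Submodule ℂ[X] V where
  carrier := {v | A v = 0}
  zero_mem' := map_zero A
  add_mem' {v w} hv hw := (map_add A v w).trans (by rw [hv.out, hw.out, add_zero])
  smul_mem' p v hv := by
    refine ext_evalAt fun l => ?_
    have := hA.value_smul l p v
    simp only [value, LinearMap.comp_apply, hv.out, map_zero, smul_zero] at this
    rw [this, map_zero]

lemma IsConformalLinear.mem_kernel {A : V →ₗ[ℂ] ℂ[X] ⊗[ℂ] V} (hA : IsConformalLinear A) {v : V} :
    v ∈ hA.kernel ↔ ∀ l, value A l v = 0 :=
  ⟨fun h l => by rw [value, LinearMap.comp_apply, h.out, map_zero],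
    fun h => ext_evalAt fun l => (h l).trans (map_zero _).symm⟩

end Kernel

namespace ConformalModule

variable {A : LieConformalAlgebra Free3} {V : Type*} [AddCommGroup V] [Module ℂ V]
  [Module ℂ[X] V] [IsScalarTower ℂ ℂ[X] V] {E : ConformalModule A V}
  {a b d e : ℂ} {g : ℂ[X]}

lemma act_eq_zero_of_kernel (hE : E.IsIrreducible) {x : Free3}
    (h : E.IsConformalSubmodule (E.isConformalLinear_act x).kernel)
    (h0 : lowDegree (E.act x) 0 ≠ ⊥) : E.act x = 0 := by
  rcases hE.2 _ h with h1 | h1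
  · obtain ⟨v, hv, hv0⟩ := (Submodule.ne_bot_iff _).1 h0
    have : v ∈ (E.isConformalLinear_act x).kernel := mem_lowDegree_zero.1 hv
    rw [h1, Submodule.mem_bot] at this
    exact absurd this hv0
  · ext1 v
    have : v ∈ (E.isConformalLinear_act x).kernel := h1 ▸ Submodule.mem_top
    exact this

lemma act_vecM_eq_zero (hA : HasTSVBrackets A a b d e g) [Module.Finite ℂ[X] V]
    (hE : E.IsIrreducible) : E.act vecM = 0 := by
  have := hE.1
  have hM := E.isConformalLinear_act vecM
  refine act_eq_zero_of_kernel hE (isConformalSubmodule_of_gen E ?_ ?_ ?_)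
    (exists_killed_of_commutator (Y := E.act vecY) hM (comm_M_Y hA)
      (h := X * g.comp (-X)) ?_ fun l v => ?_)
  · intro v hv l
    rw [hM.mem_kernel] at hv ⊢
    intro m
    have := comm_L_M (E := E) hA l m v
    rwa [hv m, hv (l + m), map_zero, smul_zero, zero_sub, neg_eq_zero] at this
  · intro v hv l
    rw [hM.mem_kernel] at hv ⊢
    intro m
    rw [comm_M_Y hA, hv m, map_zero]
  · intro v hv l
    rw [hM.mem_kernel.1 hv l]
    exact zero_mem _
  · refine mul_ne_zero X_ne_zero fun h => hA.ne_zero ?_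
    have := congrArg (fun p : ℂ[X] => p.comp (-X)) h
    simpa [comp_assoc] using this
  · have := comm_Y_Y (E := E) hA l 0 v
    rw [value_zero] at this
    rw [this]
    simp

/-- A nontrivial finite irreducible module is generated by a vector `v` on which `ℂ[∂]` acts
freely, with `L_λ v = (∂ + α λ + β) v`, `Y_λ v = γ v` and `M_λ = 0`. -/
lemma exists_generator (hA : HasTSVBrackets A a b d e g) [Module.Finite ℂ[X] V]
    (ht : ¬ E.IsTrivial) (hE : E.IsIrreducible) :
    E.act vecM = 0 ∧ ∃ v : V, (∀ p : ℂ[X], p • v = 0 → p = 0) ∧ (∀ w, ∃ p : ℂ[X], p • v = w) ∧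
      ∃ α β γ : ℂ, (∀ l, value (E.act vecL) l v = (X + C α * C l + C β : ℂ[X]) • v) ∧
        (∀ l, value (E.act vecY) l v = γ • v) ∧ (a ≠ 1 ∨ b ≠ 0 → γ = 0) := by
  have := hE.1
  have hM := act_vecM_eq_zero hA hE
  have hM' : ∀ l v, value (E.act vecM) l v = 0 := fun l v => by simp [value, hM]
  have hL := E.isConformalLinear_act vecL
  have hY := E.isConformalLinear_act vecY
  have hYY : ∀ l m v, value (E.act vecY) l (value (E.act vecY) m v) =
      value (E.act vecY) m (value (E.act vecY) l v) := fun l m v => by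
    rw [← sub_eq_zero, comm_Y_Y hA, hM', smul_zero]
  have hLY := comm_L_Y (E := E) hA
  have hY0 : lowDegree (E.act vecY) 0 ≠ ⊥ → E.act vecY = 0 := by
    refine act_eq_zero_of_kernel hE (isConformalSubmodule_of_gen E ?_ ?_ ?_)
    · intro v hv l
      rw [hY.mem_kernel] at hv ⊢
      intro m
      have := hLY l m v
      rwa [hv m, hv (l + m), map_zero, smul_zero, zero_sub, neg_eq_zero] at this
    · intro v hv l
      rw [hY.mem_kernel.1 hv l]
      exact zero_mem _
    · intro v _ l
      rw [hM' l]
      exact zero_mem _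
  have hL0 : E.act vecY = 0 → lowDegree (E.act vecL) 0 = ⊥ := by
    intro hY
    have hY' : ∀ l v, value (E.act vecY) l v = 0 := fun l v => by simp [value, hY]
    by_contra h0
    have hL' : E.act vecL = 0 := by
      refine act_eq_zero_of_kernel hE (isConformalSubmodule_of_gen E ?_ ?_ ?_) h0
      · intro v hv l
        rw [hL.mem_kernel.1 hv l]
        exact zero_mem _
      · intro v _ l
        rw [hY' l]
        exact zero_mem _
      · intro v _ l
        rw [hM' l]
        exact zero_mem _
    refine ht fun f v => ext_evalAt fun l => ?_
    refine (value_act E l f v).trans ?_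
    simp [value, hL', hY, hM]
  obtain ⟨hLY0, hcase⟩ : (∀ l m v, value (E.act vecL) l (value (E.act vecY) m v) -
      value (E.act vecY) m (value (E.act vecL) l v) =
        (0 * l - m + 0) • value (E.act vecY) (l + m) v) ∧
      ((E.act vecY = 0 ∧ lowDegree (E.act vecL) 0 = ⊥) ∨ ((a = 1 ∧ b = 0) ∧
        lowDegree (E.act vecY) 0 = ⊥ ∧ lowDegree (E.act vecY) 1 ≠ ⊥)) := by
    rcases exists_killed_or_degree_zero hY hLY hYY with h | ⟨rfl, rfl, h⟩
    · have hY0 := hY0 h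
      exact ⟨fun l m v => by simp [value, hY0], Or.inl ⟨hY0, hL0 hY0⟩⟩
    · exact ⟨fun l m v => by rw [hLY, sub_self], Or.inr ⟨⟨rfl, rfl⟩, h⟩⟩
  obtain ⟨v, hv0, hfree, α, β, γ, hLv, hYv⟩ := exists_common_weight_vector hL hY (comm_L_L hA)
    hLY0 hYY (hcase.imp_right And.right)
  refine ⟨hM, v, hfree, ?_, α, β, γ, hLv, hYv, fun hab => ?_⟩
  · have hsub : E.IsConformalSubmodule (Submodule.span ℂ[X] {v}) := by
      have hmem : ∀ p : ℂ[X], p • v ∈ Submodule.span ℂ[X] {v} := fun p =>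
        Submodule.smul_mem _ _ (Submodule.mem_span_singleton_self v)
      refine isConformalSubmodule_of_gen E ?_ ?_ ?_ <;> intro w hw l <;>
        obtain ⟨p, rfl⟩ := Submodule.mem_span_singleton.1 hw
      · rw [hL.value_smul, hLv, smul_smul]
        exact hmem _
      · rw [hY.value_smul, hYv, ← C_smul_eq, smul_smul]
        exact hmem _
      · rw [hM']
        exact zero_mem _
    rcases hE.2 _ hsub with h | h
    · exact absurd (Submodule.span_singleton_eq_bot.1 h) hv0
    · exact fun w => Submodule.mem_span_singleton.1 (h ▸ Submodule.mem_top)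
  · rcases hcase with ⟨hY0, -⟩ | ⟨⟨ha, hb⟩, -⟩
    · have : γ • v = 0 := by rw [← hYv 0]; simp [value, hY0]
      exact (smul_eq_zero.1 this).resolve_right hv0
    · exact absurd hab (by simp [ha, hb])

/-- The parameters `α` and `γ` do not both vanish, since otherwise `(∂ + β) V` would be a proper
nonzero submodule. -/
lemma alpha_ne_zero_or_gamma_ne_zero (hE : E.IsIrreducible) (hM : E.act vecM = 0) {v : V}
    (hfree : ∀ p : ℂ[X], p • v = 0 → p = 0) {α β γ : ℂ}
    (hLv : ∀ l, value (E.act vecL) l v = (X + C α * C l + C β : ℂ[X]) • v)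
    (hYv : ∀ l, value (E.act vecY) l v = γ • v) : α ≠ 0 ∨ γ ≠ 0 := by
  by_contra! h
  obtain ⟨rfl, rfl⟩ := h
  have hL := E.isConformalLinear_act vecL
  have hY := E.isConformalLinear_act vecY
  let S : Submodule ℂ[X] V := Submodule.span ℂ[X] {(X + C β : ℂ[X]) • v}
  have hmem : ∀ p : ℂ[X], (p * (X + C β)) • v ∈ S := fun p => by
    rw [mul_smul]
    exact Submodule.smul_mem _ _ (Submodule.mem_span_singleton_self _)
  have hsub : E.IsConformalSubmodule S := by
    refine isConformalSubmodule_of_gen E ?_ ?_ ?_ <;> intro w hw l <;>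
      obtain ⟨p, rfl⟩ := Submodule.mem_span_singleton.1 hw
    · rw [smul_smul, hL.value_smul, hLv, smul_smul, C_0, zero_mul, add_zero]
      exact hmem _
    · rw [smul_smul, hY.value_smul, hYv, zero_smul, smul_zero]
      exact zero_mem _
    · simp [value, hM]
  rcases hE.2 _ hsub with h | h
  · exact X_add_C_ne_zero β (hfree _ (Submodule.span_singleton_eq_bot.1 h))
  · obtain ⟨p, hp⟩ := Submodule.mem_span_singleton.1 (h ▸ Submodule.mem_top : v ∈ S)
    have := hfree (p * (X + C β) - 1) (by rw [sub_smul, mul_smul, hp, one_smul, sub_self])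
    simpa using congrArg (eval (-β)) this

/-- A module freely generated by a vector `v` as above is the rank one module with the same
parameters. -/
lemma isIso_of_generator (hM : E.act vecM = 0) {v : V}
    (hfree : ∀ p : ℂ[X], p • v = 0 → p = 0) (hgen : ∀ w, ∃ p : ℂ[X], p • v = w) {α β γ : ℂ}
    (hLv : ∀ l, value (E.act vecL) l v = (X + C α * C l + C β : ℂ[X]) • v)
    (hYv : ∀ l, value (E.act vecY) l v = γ • v) {E' : ConformalModule A ℂ[X]}
    (hE' : E'.act = tableAct (rankOneTable α β γ)) :
    Module.Free ℂ[X] V ∧ Module.finrank ℂ[X] V = 1 ∧ E.IsIso E' := by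
  let u : ℂ[X] ≃ₗ[ℂ[X]] V := LinearEquiv.ofBijective (LinearMap.toSpanSingleton ℂ[X] V v)
    ⟨(injective_iff_map_eq_zero _).2 hfree, hgen⟩
  have hu : ∀ p, u p = p • v := fun p => rfl
  refine ⟨Module.Free.of_equiv u, by rw [← u.finrank_eq, Module.finrank_self], u.symm, ?_⟩
  intro f w l
  obtain ⟨p, rfl⟩ := u.surjective w
  rw [u.symm_apply_apply, LinearEquiv.symm_apply_eq, hE']
  have h' : evalAt l (tableAct (rankOneTable α β γ) f p) = _ := subst_rankOne (C l) α β γ f p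
  have hM' : value (E.act vecM) l (p • v) = 0 := by simp [value, hM]
  change value (E.act f) l (u p) = _
  rw [h', hu, hu, value_act, (E.isConformalLinear_act vecL).value_smul,
    (E.isConformalLinear_act vecY).value_smul, hLv, hYv, hM', comp_neg_C, comp_neg_C,
    ← C_smul_eq γ, ← C_smul_eq (eval (-l) (f 0)), ← C_smul_eq (eval (-l) (f 1)), smul_smul,
    smul_smul, smul_smul, smul_smul, smul_zero, add_zero, ← add_smul, mul_assoc, mul_assoc]

end ConformalModule

end Conformal
end

theorem theorem4p1 :
    (∀ a b : ℂ, (a ≠ 1 ∨ b ≠ 0) →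
      ∀ (V : Type*) [AddCommGroup V] [Module ℂ V] [Module ℂ[X] V] [IsScalarTower ℂ ℂ[X] V]
        (E : Conformal.ConformalModule (Conformal.TSV a b) V),
        Module.Finite ℂ[X] V → ¬ E.IsTrivial → E.IsIrreducible →
          Module.Free ℂ[X] V ∧ Module.finrank ℂ[X] V = 1 ∧
            (∃ α β : ℂ, α ≠ 0 ∧ E.IsIso (Conformal.modTSV a b α β)) ∧
            ∀ v : V, E.act Conformal.vecM v = 0) ∧
    (∀ (V : Type*) [AddCommGroup V] [Module ℂ V] [Module ℂ[X] V] [IsScalarTower ℂ ℂ[X] V]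
        (E : Conformal.ConformalModule (Conformal.TSV 1 0) V),
        Module.Finite ℂ[X] V → ¬ E.IsTrivial → E.IsIrreducible →
          Module.Free ℂ[X] V ∧ Module.finrank ℂ[X] V = 1 ∧
            (∃ α β γ : ℂ, (α ≠ 0 ∨ γ ≠ 0) ∧ E.IsIso (Conformal.modTSV10 α β γ)) ∧
            ∀ v : V, E.act Conformal.vecM v = 0) ∧
    (∀ (c : ℂ) (V : Type*) [AddCommGroup V] [Module ℂ V] [Module ℂ[X] V] [IsScalarTower ℂ ℂ[X] V]
        (E : Conformal.ConformalModule (Conformal.TSVc c) V),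
        Module.Finite ℂ[X] V → ¬ E.IsTrivial → E.IsIrreducible →
          Module.Free ℂ[X] V ∧ Module.finrank ℂ[X] V = 1 ∧
            (∃ α β : ℂ, α ≠ 0 ∧ E.IsIso (Conformal.modTSVc c α β)) ∧
            ∀ v : V, E.act Conformal.vecM v = 0) := by
  refine ⟨fun a b hab V _ _ _ _ E _ ht hE => ?_, fun V _ _ _ _ E _ ht hE => ?_,
    fun c V _ _ _ _ E _ ht hE => ?_⟩
  · obtain ⟨hM, v, hfree, hgen, α, β, γ, hL, hY, hγ⟩ :=
      E.exists_generator (Conformal.hasTSVBrackets_TSV a b) ht hE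
    have hαγ := E.alpha_ne_zero_or_gamma_ne_zero hE hM hfree hL hY
    obtain rfl := hγ hab
    obtain ⟨h1, h2, h3⟩ := E.isIso_of_generator hM hfree hgen hL hY
      (E' := Conformal.modTSV a b α β) rfl
    exact ⟨h1, h2, ⟨α, β, by simpa using hαγ, h3⟩, fun w => by rw [hM]; rfl⟩
  · obtain ⟨hM, v, hfree, hgen, α, β, γ, hL, hY, -⟩ :=
      E.exists_generator (Conformal.hasTSVBrackets_TSV 1 0) ht hE
    have hαγ := E.alpha_ne_zero_or_gamma_ne_zero hE hM hfree hL hY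
    obtain ⟨h1, h2, h3⟩ := E.isIso_of_generator hM hfree hgen hL hY
      (E' := Conformal.modTSV10 α β γ) rfl
    exact ⟨h1, h2, ⟨α, β, γ, hαγ, h3⟩, fun w => by rw [hM]; rfl⟩
  · obtain ⟨hM, v, hfree, hgen, α, β, γ, hL, hY, hγ⟩ :=
      E.exists_generator (Conformal.hasTSVBrackets_TSVc c) ht hE
    have hαγ := E.alpha_ne_zero_or_gamma_ne_zero hE hM hfree hL hY
    -- The conformal weight of `Y` is `3 / 2`, which is not `1`.
    obtain rfl := hγ (Or.inl (by norm_num))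
    obtain ⟨h1, h2, h3⟩ := E.isIso_of_generator hM hfree hgen hL hY
      (E' := Conformal.modTSVc c α β) rfl
    exact ⟨h1, h2, ⟨α, β, by simpa using hαγ, h3⟩, fun w => by rw [hM]; rfl⟩
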